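/- Let $d\ge 1$ and let $a:\mathbb R^d\to[0,\infty)$ be a spherically symmetric kernel ($a(x)$ depends only on $|x|$) with $a\in L^1\cap L^\infty$, $\int a\,dx=1$ and $\int |x|^2a(x)\,dx<\infty$. Assume that for some $b>0$, $p\ge 1$ and some constant $C_1$ one has $a(x)\le C_1e^{-b|x|^p}$ for all $x$, and that in the case $p=1$ also condition ($A_1$) holds: $\mathbb E\,e^{b_1X\cdot\theta}=\infty$ for every $b_1>b$ and every unit vector $\theta$. Here and below $X$ is a random vector with density $a$. Put $$v(x,t)=e^{-t}\sum_{k=1}^{\infty}\frac{t^k a^{*k}(x)}{k!},\qquad L(\gamma)=\ln\mathbb E\,e^{\gamma\cdot X},\qquad I(r)=\sup_{\gamma\in\mathbb R^d}\big(\gamma\cdot r-L(\gamma)\big).$$ The convolution powers $a^{*k}(x)$ exist and the series for $v$ converges for all $x$ and $t$. For each $r\in\mathbb R^d\setminus\{0\}$ there is a unique $\xi=\xi_r>0$ such that $I$ is finite near $\xi r$, differentiable at $\xi r$, and $$\ln\xi=I(\xi r)-\xi r\cdot\nabla I(\xi r).$$ Let $$\Phi(r)=1-\frac1{\xi_r}\big(1+\ln\xi_r-I(\xi_r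 r)\big).$$ Then $\Phi(r)$ depends only on $|r|$, so that we may write $\Phi(r)=\Phi(|r|)$; the covariance matrix $\big(\int x_ix_ja(x)\,dx\big)_{ij}$ equals $\sigma\,\mathrm{Id}$ with a number $\sigma>0$; and the following hold. 1. For every $s>0$ and every $x=x(t)$ with $|x|=st(1+o(1))$ as $t\to\infty$, $$v(x,t)\le e^{-\Phi(s)t(1+o(1))}\qquad\text{as }t\to\infty .$$ 2. $\Phi(s)=\dfrac{s^2}{2\sigma}(1+o(1))$ as $s\to0+$, and $\Phi(s)\to\infty$ as $s\to\infty$. 3. If $p=1$, then $\Phi(s)=bs(1+o(1))$ as $s\to\infty$. 4. If $p>1$ and condition ($A_p$) holds, that is, $L(\gamma)=\frac{p-1}{p}(bp)^{-1/(p-1)}|\gamma|^{p/(p-1)}(1+o(1))$ as $|\gamma|\to\infty$, then $$\Phi(s)=\frac p{p-1}\big(b(p-1)\big)^{1/p}s(\ln s)^{\frac{p-1}p}(1+o(1))\qquad\text{as }s\to\infty .$$ 5. If $a$ is continuous and supported in the ball $\{|x|\le\mu\}$ for some $\mu>0$ (in particular for the smallest such $\mu$), then $\Phi(s)\ge\frac1\mu\,s\ln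 s$ for all sufficiently large $s$. -/

import Mathlib

open Filter Topology MeasureTheory Asymptotics

noncomputable section

namespace NonlocalHeat

/-- Standing assumptions on the convolution kernel `a` on `ℝ^d`: it is nonnegative, even, belongs to
`L^∞ ∩ L^1`, has total mass one and a finite second moment. -/
structure IsKernel {d : ℕ} (a : EuclideanSpace ℝ (Fin d) → ℝ) : Prop where
  nonneg : ∀ x, 0 ≤ a x
  even : ∀ x, a (-x) = a x
  memLp_top : MemLp a ⊤ volume
  integrable : Integrable a volume
  integral_eq_one : ∫ x, a x = 1
  integrable_sq : Integrable (fun x => ‖x‖ ^ 2 * a x) volume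

/-- Light tail: `a(x) ≤ C e^{-b |x|^p}` for some constant `C`. -/
def LightTail {d : ℕ} (a : EuclideanSpace ℝ (Fin d) → ℝ) (b p : ℝ) : Prop :=
  ∃ C : ℝ, ∀ x, a x ≤ C * Real.exp (-b * ‖x‖ ^ p)

/-- `a` is continuous and its support is contained in the closed ball of radius `μ`. -/
def SupportedInBall {d : ℕ} (a : EuclideanSpace ℝ (Fin d) → ℝ) (μ : ℝ) : Prop :=
  Continuous a ∧ tsupport a ⊆ Metric.closedBall 0 μ

/-- Spherical symmetry: `a(x)` depends on `|x|` only. -/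
def IsRadial {d : ℕ} (a : EuclideanSpace ℝ (Fin d) → ℝ) : Prop :=
  ∀ x y, ‖x‖ = ‖y‖ → a x = a y

/-- The exponential moment `Λ(γ) = E e^{γ · X}`, where `X` has density `a`; it may be infinite. -/
def expMoment {d : ℕ} (a : EuclideanSpace ℝ (Fin d) → ℝ) (γ : EuclideanSpace ℝ (Fin d)) : ENNReal :=
  ∫⁻ x, ENNReal.ofReal (Real.exp (inner ℝ γ x) * a x)

/-- The cumulant generating function `L(γ) = ln Λ(γ)`, with values in `[-∞, ∞]`. -/
def cumulant {d : ℕ} (a : EuclideanSpace ℝ (Fin d) → ℝ) (γ : EuclideanSpace ℝ (Fin d)) : EReal :=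
  ENNReal.log (expMoment a γ)

/-- The rate function `I(r) = sup_γ (γ · r - L(γ))`, which may take the value `∞`. -/
def rate {d : ℕ} (a : EuclideanSpace ℝ (Fin d) → ℝ) (r : EuclideanSpace ℝ (Fin d)) : EReal :=
  ⨆ γ : EuclideanSpace ℝ (Fin d), ((inner ℝ γ r : ℝ) : EReal) - cumulant a γ

/-- The rate function as a real function; meaningful where `rate` is finite. -/
def rateReal {d : ℕ} (a : EuclideanSpace ℝ (Fin d) → ℝ) (r : EuclideanSpace ℝ (Fin d)) : ℝ :=
  (rate a r).toReal

/-- `ξ > 0` solves `ln ξ = I(ξ r) - ξ r · ∇I(ξ r)`. This presupposes that `I` is finite near `ξ r`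
and differentiable at `ξ r`. -/
def IsXi {d : ℕ} (a : EuclideanSpace ℝ (Fin d) → ℝ) (r : EuclideanSpace ℝ (Fin d)) (ξ : ℝ) : Prop :=
  0 < ξ ∧ (∀ᶠ y in 𝓝 (ξ • r), rate a y ≠ ⊤) ∧
    DifferentiableAt ℝ (rateReal a) (ξ • r) ∧
    Real.log ξ = rateReal a (ξ • r) - inner ℝ (ξ • r) (gradient (rateReal a) (ξ • r))

/-- The solution `ξ_r` (a chosen one; its existence and uniqueness have to be established). -/
def xi {d : ℕ} (a : EuclideanSpace ℝ (Fin d) → ℝ) (r : EuclideanSpace ℝ (Fin d)) : ℝ :=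
  Classical.epsilon (IsXi a r)

/-- `Φ(r) = 1 - (1 + ln ξ_r - I(ξ_r r)) / ξ_r`. -/
def Phi {d : ℕ} (a : EuclideanSpace ℝ (Fin d) → ℝ) (r : EuclideanSpace ℝ (Fin d)) : ℝ :=
  1 - 1 / xi a r * (1 + Real.log (xi a r) - rateReal a (xi a r • r))

/-- Condition `A_1`: `E e^{b₁ X · θ} = ∞` for all `b₁ > b` and all unit vectors `θ`. -/
def CondA1 {d : ℕ} (a : EuclideanSpace ℝ (Fin d) → ℝ) (b : ℝ) : Prop :=
  ∀ b₁ : ℝ, b < b₁ → ∀ θ : EuclideanSpace ℝ (Fin d), ‖θ‖ = 1 → expMoment a (b₁ • θ) = ⊤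

/-- Condition `A_p`, for `p > 1`: `L(γ) = C(b,p) |γ|^{p/(p-1)} (1 + o(1))` as `|γ| → ∞`, where
`C(b,p) = ((p-1)/p) (b p)^{-1/(p-1)}`. -/
def CondAp {d : ℕ} (a : EuclideanSpace ℝ (Fin d) → ℝ) (b p : ℝ) : Prop :=
  (fun γ : EuclideanSpace ℝ (Fin d) => (cumulant a γ).toReal)
    ~[Bornology.cobounded (EuclideanSpace ℝ (Fin d))]
  (fun γ => (p - 1) / p * (b * p) ^ (-(1 / (p - 1))) * ‖γ‖ ^ (p / (p - 1)))

/-- Convolution powers: `convPow a k` is `a^{*(k+1)}`. -/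
def convPow {d : ℕ} (a : EuclideanSpace ℝ (Fin d) → ℝ) : ℕ → EuclideanSpace ℝ (Fin d) → ℝ
  | 0 => a
  | k + 1 => convolution (convPow a k) a (ContinuousLinearMap.lsmul ℝ ℝ) volume

/-- `heatTerm a x t k` is `t^n a^{*n}(x) / n!` with `n = k + 1`. -/
def heatTerm {d : ℕ} (a : EuclideanSpace ℝ (Fin d) → ℝ) (x : EuclideanSpace ℝ (Fin d)) (t : ℝ)
    (k : ℕ) : ℝ :=
  t ^ (k + 1) * convPow a k x / (Nat.factorial (k + 1) : ℝ)

/-- The regularized heat kernel `v(x,t) = e^{-t} ∑_{k ≥ 1} t^k a^{*k}(x) / k!`. -/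
def heatKernel {d : ℕ} (a : EuclideanSpace ℝ (Fin d) → ℝ) (x : EuclideanSpace ℝ (Fin d)) (t : ℝ) :
    ℝ :=
  Real.exp (-t) * ∑' k : ℕ, heatTerm a x t k

/-- The covariance matrix `σ_{ij} = ∫ x_i x_j a(x) dx`. -/
def covMatrix {d : ℕ} (a : EuclideanSpace ℝ (Fin d) → ℝ) : Matrix (Fin d) (Fin d) ℝ :=
  Matrix.of fun i j => ∫ x, x i * x j * a x

end NonlocalHeat

end

/-! Write `Λ` for the exponential moment and `L = ln Λ`. If `γ₀` attains the supremum defining `I(ξ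
r)`, then `γ₀ = ∇I(ξ r)` and the equation for `ξ` reads `ln ξ = -L(γ₀)`, that is `ξ = 1/Λ(γ₀)`.
Formally, `ξ r = ∇L(γ₀) = ∇Λ(γ₀)/Λ(γ₀)` then becomes `r = ∇Λ(γ₀)`: `γ₀` maximizes `γ · r - Λ(γ)`.
Conversely, such a maximizer produces a solution `ξ` (`IsMomentMax.isXi`,
`IsXi.exists_isMomentMax`). Strict convexity of `Λ` makes the maximizer, hence `ξ`, unique, and
substitution gives `Φ(r) = max_γ (γ · r - Λ(γ) + 1)` (`IsMomentMax.phi_eq`).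

When `p = 1` the maximizer may lie on the boundary of the domain of `Λ`, so the argument never
differentiates `Λ`. It compares maximizers, uses lower semicontinuity (Fatou) for existence, and
obtains differentiability of `I` from uniqueness of the maximizer (`IsLegendreMax.hasGradientAt`).

The heat kernel bound is a Chernoff estimate. Tilting is multiplicative under convolution, so
`a^{*(k+1)}(x) ≤ A Λ(γ)^k e^{-γ·x}` (`IsKernel.convPow_le`). Summation gives `v(x,t) ≤ A exp(t(Λ(γ)
- 1) - γ · x)`, and the best `γ` parallel to `x` gives the exponent `-Φ(s) t`.

By radial symmetry only `M(l) = Λ(l e)`, for a unit vector `e`, matters, and `φ(s) = max_l (l s -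
M(l) + 1)`. Each asymptotic claim follows from a property of `M`: its Taylor expansion at `0`, the
endpoint `b` of its domain, the growth of `ln M`, or `M(l) = o(e^{μ l})`. Lower bounds for `φ` come
from a trial `l`, upper bounds from lower bounds for `M` or from the size of the domain. -/

namespace NonlocalHeat

variable {d : ℕ} {a : EuclideanSpace ℝ (Fin d) → ℝ}

/-! ### Exponential moment: symmetry, strict convexity, semicontinuity. -/

/-- The set of `γ` at which the exponential moment is finite. -/
def effDomain (a : EuclideanSpace ℝ (Fin d) → ℝ) : Set (EuclideanSpace ℝ (Fin d)) :=
  {γ | expMoment a γ ≠ ⊤}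

/-- The exponential moment as a real number; meaningful on `effDomain a`. -/
noncomputable def momentReal (a : EuclideanSpace ℝ (Fin d) → ℝ)
    (γ : EuclideanSpace ℝ (Fin d)) : ℝ :=
  (expMoment a γ).toReal

/-- The real cumulant generating function; meaningful on `effDomain a`. -/
noncomputable def logMoment (a : EuclideanSpace ℝ (Fin d) → ℝ)
    (γ : EuclideanSpace ℝ (Fin d)) : ℝ :=
  Real.log (momentReal a γ)

lemma IsKernel.aestronglyMeasurable_mul (ha : IsKernel a)
    {f : EuclideanSpace ℝ (Fin d) → ℝ} (hf : Continuous f) :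
    AEStronglyMeasurable (fun x => f x * a x) volume :=
  hf.aestronglyMeasurable.mul ha.integrable.aestronglyMeasurable

lemma IsKernel.aestronglyMeasurable_exp (ha : IsKernel a) (γ : EuclideanSpace ℝ (Fin d)) :
    AEStronglyMeasurable (fun x => Real.exp (inner ℝ γ x) * a x) volume :=
  ha.aestronglyMeasurable_mul (by fun_prop)

lemma IsKernel.mem_effDomain_iff (ha : IsKernel a) {γ : EuclideanSpace ℝ (Fin d)} :
    γ ∈ effDomain a ↔ Integrable (fun x => Real.exp (inner ℝ γ x) * a x) volume :=
  lintegral_ofReal_ne_top_iff_integrable (ha.aestronglyMeasurable_exp γ)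
    (Eventually.of_forall fun x => mul_nonneg (Real.exp_pos _).le (ha.nonneg x))

lemma IsKernel.momentReal_eq (ha : IsKernel a) (γ : EuclideanSpace ℝ (Fin d)) :
    momentReal a γ = ∫ x, Real.exp (inner ℝ γ x) * a x :=
  (integral_eq_lintegral_of_nonneg_ae
    (Eventually.of_forall fun x => mul_nonneg (Real.exp_pos _).le (ha.nonneg x))
    (ha.aestronglyMeasurable_exp γ)).symm

lemma IsKernel.zero_mem_effDomain (ha : IsKernel a) : (0 : EuclideanSpace ℝ (Fin d)) ∈ effDomain a := by
  rw [ha.mem_effDomain_iff]; simpa using ha.integrable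

lemma IsKernel.momentReal_zero (ha : IsKernel a) : momentReal a 0 = 1 := by
  rw [ha.momentReal_eq]; simpa using ha.integral_eq_one

/-- A radial kernel sees linear functionals of equal norm in the same way. -/
lemma IsRadial.comp_reflection (hrad : IsRadial a) (u v : EuclideanSpace ℝ (Fin d))
    (x : EuclideanSpace ℝ (Fin d)) : a ((Submodule.reflection (ℝ ∙ (u - v))ᗮ) x) = a x :=
  hrad _ _ (LinearIsometryEquiv.norm_map _ _)

/-- The reflection in the hyperplane orthogonal to `u - v` exchanges `u` and `v` and is an isometric
involution. It is the change of variables behind all the radial identities. -/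
lemma inner_reflection {u v : EuclideanSpace ℝ (Fin d)} (h : ‖u‖ = ‖v‖)
    (x : EuclideanSpace ℝ (Fin d)) :
    inner ℝ u ((Submodule.reflection (ℝ ∙ (u - v))ᗮ) x) = (inner ℝ v x : ℝ) := by
  have h1 := LinearIsometryEquiv.inner_map_map (Submodule.reflection (ℝ ∙ (u - v))ᗮ) u
    ((Submodule.reflection (ℝ ∙ (u - v))ᗮ) x)
  rw [Submodule.reflection_sub h, Submodule.reflection_reflection] at h1
  exact h1.symm

lemma IsRadial.integral_inner_eq (hrad : IsRadial a) (f : ℝ → ℝ)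
    {u v : EuclideanSpace ℝ (Fin d)} (h : ‖u‖ = ‖v‖) :
    ∫ x, f (inner ℝ u x) * a x = ∫ x, f (inner ℝ v x) * a x := by
  rw [← (LinearIsometryEquiv.measurePreserving
    (Submodule.reflection (ℝ ∙ (u - v))ᗮ)).integral_comp
    (Submodule.reflection (ℝ ∙ (u - v))ᗮ).toHomeomorph.measurableEmbedding]
  simp only [inner_reflection h, hrad.comp_reflection]

lemma IsRadial.expMoment_eq (hrad : IsRadial a)
    {u v : EuclideanSpace ℝ (Fin d)} (h : ‖u‖ = ‖v‖) : expMoment a u = expMoment a v := by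
  unfold expMoment
  rw [← (LinearIsometryEquiv.measurePreserving
    (Submodule.reflection (ℝ ∙ (u - v))ᗮ)).lintegral_comp_emb
    (Submodule.reflection (ℝ ∙ (u - v))ᗮ).toHomeomorph.measurableEmbedding]
  simp only [inner_reflection h, hrad.comp_reflection]

lemma IsRadial.momentReal_eq_of_norm_eq (hrad : IsRadial a)
    {u v : EuclideanSpace ℝ (Fin d)} (h : ‖u‖ = ‖v‖) : momentReal a u = momentReal a v := by
  rw [momentReal, momentReal, hrad.expMoment_eq h]

lemma IsRadial.mem_effDomain_congr (hrad : IsRadial a)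
    {u v : EuclideanSpace ℝ (Fin d)} (h : ‖u‖ = ‖v‖) : u ∈ effDomain a ↔ v ∈ effDomain a := by
  simp only [effDomain, Set.mem_ofPred_eq, hrad.expMoment_eq h]

/-- Hyperplanes are null sets. -/
lemma volume_hyperplane {δ : EuclideanSpace ℝ (Fin d)} (hδ : δ ≠ 0) (c : ℝ) :
    volume {x : EuclideanSpace ℝ (Fin d) | inner ℝ δ x = c} = 0 := by
  let S : AffineSubspace ℝ (EuclideanSpace ℝ (Fin d)) :=
    AffineSubspace.mk' ((c / ‖δ‖ ^ 2) • δ) (innerSL ℝ δ).ker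
  have hδ' : ‖δ‖ ^ 2 ≠ 0 := by simpa using hδ
  have hS : (S : Set (EuclideanSpace ℝ (Fin d))) = {x | inner ℝ δ x = c} := by
    ext x
    simp only [S, SetLike.mem_coe, AffineSubspace.mem_mk', vsub_eq_sub, LinearMap.mem_ker,
      Set.mem_ofPred_eq]
    change (innerSL ℝ δ) (x - (c / ‖δ‖ ^ 2) • δ) = 0 ↔ _
    simp only [innerSL_apply_apply, inner_sub_right, inner_smul_right, real_inner_self_eq_norm_sq]
    rw [div_mul_cancel₀ _ hδ', sub_eq_zero]
  rw [← hS]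
  refine Measure.addHaar_affineSubspace _ _ fun htop => ?_
  have : ((c / ‖δ‖ ^ 2) • δ + δ) ∈ (S : Set (EuclideanSpace ℝ (Fin d))) := by
    rw [htop]; trivial
  rw [hS] at this
  simp only [Set.mem_ofPred_eq, inner_add_right, inner_smul_right,
    real_inner_self_eq_norm_sq] at this
  rw [div_mul_cancel₀ _ hδ'] at this
  exact hδ' (by linarith)

/-- A nonnegative function vanishing at most on a hyperplane has positive mean. -/
lemma IsKernel.integral_mul_pos (ha : IsKernel a) {f : EuclideanSpace ℝ (Fin d) → ℝ}
    (hf : ∀ x, 0 ≤ f x) (hi : Integrable (fun x => f x * a x) volume)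
    {δ : EuclideanSpace ℝ (Fin d)} (hδ : δ ≠ 0) (c : ℝ) (hz : ∀ x, f x = 0 → inner ℝ δ x = c) :
    0 < ∫ x, f x * a x := by
  refine (integral_nonneg fun x => mul_nonneg (hf x) (ha.nonneg x)).lt_of_ne' fun h0 => ?_
  rw [integral_eq_zero_iff_of_nonneg (fun x => mul_nonneg (hf x) (ha.nonneg x)) hi] at h0
  have h1 : a =ᵐ[volume] 0 := by
    have h2 : ∀ᵐ x ∂(volume : Measure (EuclideanSpace ℝ (Fin d))), ¬ (inner ℝ δ x = c) := by
      simpa [ae_iff] using volume_hyperplane hδ c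
    filter_upwards [h0, h2] with x hx hx2
    rcases mul_eq_zero.1 hx with h | h
    · exact absurd (hz x h) hx2
    · exact h
  have := ha.integral_eq_one
  rw [integral_congr_ae h1] at this
  simp at this

lemma IsKernel.momentReal_pos (ha : IsKernel a) (hd : 1 ≤ d) {γ : EuclideanSpace ℝ (Fin d)}
    (hγ : γ ∈ effDomain a) : 0 < momentReal a γ := by
  rw [ha.momentReal_eq]
  refine ha.integral_mul_pos (fun x => (Real.exp_pos _).le) (ha.mem_effDomain_iff.1 hγ)
    (δ := EuclideanSpace.single ⟨0, hd⟩ 1) (by simp) 0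
    fun x hx => absurd hx (Real.exp_pos _).ne'

/-- Fatou's lemma. On the domain the function is `exp(L(γ) - γ · r)`, so minimizing it is the
Legendre problem at `r`; values in `ENNReal` include the points where the moment is infinite. -/
lemma lowerSemicontinuous_tilt (ha : IsKernel a) (r : EuclideanSpace ℝ (Fin d)) :
    LowerSemicontinuous fun γ => expMoment a γ * ENNReal.ofReal (Real.exp (-inner ℝ γ r)) := by
  have h0 : ∀ γ, expMoment a γ * ENNReal.ofReal (Real.exp (-inner ℝ γ r)) =
      ∫⁻ x, ENNReal.ofReal (Real.exp (inner ℝ γ (x - r)) * a x) := fun γ => by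
    rw [expMoment, ← lintegral_mul_const' _ _ ENNReal.ofReal_ne_top]
    refine lintegral_congr fun x => ?_
    rw [← ENNReal.ofReal_mul (mul_nonneg (Real.exp_pos _).le (ha.nonneg x)), inner_sub_right,
      sub_eq_add_neg, Real.exp_add]
    congr 1; ring
  simp only [h0]
  rw [lowerSemicontinuous_iff_le_liminf]
  intro γ
  have h1 : ∀ x, ENNReal.ofReal (Real.exp (inner ℝ γ (x - r)) * a x) =
      liminf (fun η => ENNReal.ofReal (Real.exp (inner ℝ η (x - r)) * a x)) (𝓝 γ) := fun x => by
    refine (Tendsto.liminf_eq (ENNReal.tendsto_ofReal ?_)).symm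
    have : Continuous fun η : EuclideanSpace ℝ (Fin d) =>
        Real.exp (inner ℝ η (x - r)) * a x := by
      fun_prop
    exact this.tendsto γ
  simp only [h1]
  refine lintegral_liminf_le' fun η => ?_
  exact (ha.aestronglyMeasurable_mul (by fun_prop)).aemeasurable.ennreal_ofReal

lemma lowerSemicontinuous_expMoment (ha : IsKernel a) : LowerSemicontinuous (expMoment a) := by
  simpa using lowerSemicontinuous_tilt ha 0

lemma exp_combo_lt {u v t : ℝ} (huv : u ≠ v) (h0 : 0 < t) (h1 : t < 1) :
    Real.exp ((1 - t) * u + t * v) < (1 - t) * Real.exp u + t * Real.exp v := by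
  have := strictConvexOn_exp.2 (Set.mem_univ u) (Set.mem_univ v) huv (sub_pos.2 h1) h0 (by ring)
  simpa using this

lemma exp_combo_le {u v t : ℝ} (h0 : 0 < t) (h1 : t < 1) :
    Real.exp ((1 - t) * u + t * v) ≤ (1 - t) * Real.exp u + t * Real.exp v := by
  rcases eq_or_ne u v with rfl | h
  · refine le_of_eq ?_
    rw [show (1 - t) * u + t * u = u by ring]; ring
  · exact (exp_combo_lt h h0 h1).le

/-- Strict convexity of the cumulant generating function on its effective domain. -/
lemma IsKernel.logMoment_combo_lt (ha : IsKernel a) (hd : 1 ≤ d)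
    {γ₁ γ₂ : EuclideanSpace ℝ (Fin d)} (h₁ : γ₁ ∈ effDomain a) (h₂ : γ₂ ∈ effDomain a)
    (hne : γ₁ ≠ γ₂) {t : ℝ} (h0 : 0 < t) (h1 : t < 1) :
    (1 - t) • γ₁ + t • γ₂ ∈ effDomain a ∧
      logMoment a ((1 - t) • γ₁ + t • γ₂) < (1 - t) * logMoment a γ₁ + t * logMoment a γ₂ := by
  have hp₁ := ha.momentReal_pos hd h₁
  have hp₂ := ha.momentReal_pos hd h₂
  have hi₁ := ha.mem_effDomain_iff.1 h₁
  have hi₂ := ha.mem_effDomain_iff.1 h₂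
  set L₁ := logMoment a γ₁ with hL₁
  set L₂ := logMoment a γ₂ with hL₂
  set K := (1 - t) * L₁ + t * L₂ with hK
  -- The gap in the convexity inequality for `exp`, after both tilted densities are normalized to
  -- mass one. It vanishes only where `(γ₁ - γ₂) · x = L₁ - L₂`, a hyperplane, so its mean is
  -- strictly positive.
  let f : EuclideanSpace ℝ (Fin d) → ℝ := fun x =>
    ((1 - t) * Real.exp (inner ℝ γ₁ x - L₁) + t * Real.exp (inner ℝ γ₂ x - L₂))
      - Real.exp ((1 - t) * (inner ℝ γ₁ x - L₁) + t * (inner ℝ γ₂ x - L₂))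
  have hexp : ∀ x, Real.exp ((1 - t) * (inner ℝ γ₁ x - L₁) + t * (inner ℝ γ₂ x - L₂)) =
      Real.exp (-K) * Real.exp (inner ℝ ((1 - t) • γ₁ + t • γ₂) x) := fun x => by
    rw [← Real.exp_add, inner_add_left, real_inner_smul_left, real_inner_smul_left, hK]
    congr 1; ring
  have hf : ∀ x, 0 ≤ f x := fun x => sub_nonneg.2 (exp_combo_le h0 h1)
  have hj₁ : Integrable (fun x => Real.exp (inner ℝ γ₁ x - L₁) * a x) volume := by
    convert hi₁.const_mul (Real.exp (-L₁)) using 2 with x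
    rw [sub_eq_add_neg, Real.exp_add]; ring
  have hj₂ : Integrable (fun x => Real.exp (inner ℝ γ₂ x - L₂) * a x) volume := by
    convert hi₂.const_mul (Real.exp (-L₂)) using 2 with x
    rw [sub_eq_add_neg, Real.exp_add]; ring
  have hv₁ : ∫ x, Real.exp (inner ℝ γ₁ x - L₁) * a x = 1 := by
    have : ∀ x, Real.exp (inner ℝ γ₁ x - L₁) * a x =
        Real.exp (-L₁) * (Real.exp (inner ℝ γ₁ x) * a x) := fun x => by
      rw [sub_eq_add_neg, Real.exp_add]; ring
    simp only [this]
    rw [integral_const_mul, ← ha.momentReal_eq, hL₁, logMoment, Real.exp_neg, Real.exp_log hp₁]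
    exact inv_mul_cancel₀ hp₁.ne'
  have hv₂ : ∫ x, Real.exp (inner ℝ γ₂ x - L₂) * a x = 1 := by
    have : ∀ x, Real.exp (inner ℝ γ₂ x - L₂) * a x =
        Real.exp (-L₂) * (Real.exp (inner ℝ γ₂ x) * a x) := fun x => by
      rw [sub_eq_add_neg, Real.exp_add]; ring
    simp only [this]
    rw [integral_const_mul, ← ha.momentReal_eq, hL₂, logMoment, Real.exp_neg, Real.exp_log hp₂]
    exact inv_mul_cancel₀ hp₂.ne'
  have hsum : Integrable (fun x => ((1 - t) * Real.exp (inner ℝ γ₁ x - L₁) +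
      t * Real.exp (inner ℝ γ₂ x - L₂)) * a x) volume := by
    refine ((hj₁.const_mul (1 - t)).add (hj₂.const_mul t)).congr
      (Eventually.of_forall fun x => ?_)
    simp only [Pi.add_apply]
    ring
  have hsumv : ∫ x, ((1 - t) * Real.exp (inner ℝ γ₁ x - L₁) +
      t * Real.exp (inner ℝ γ₂ x - L₂)) * a x = 1 := by
    have : ∀ x, ((1 - t) * Real.exp (inner ℝ γ₁ x - L₁) +
      t * Real.exp (inner ℝ γ₂ x - L₂)) * a x = (1 - t) * (Real.exp (inner ℝ γ₁ x - L₁) * a x) +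
        t * (Real.exp (inner ℝ γ₂ x - L₂) * a x) := fun x => by ring
    simp only [this]
    rw [integral_add (hj₁.const_mul _) (hj₂.const_mul _), integral_const_mul, integral_const_mul,
      hv₁, hv₂]
    ring
  have hm : Integrable (fun x => Real.exp (inner ℝ ((1 - t) • γ₁ + t • γ₂) x) * a x) volume := by
    refine (hsum.const_mul (Real.exp K)).mono' (ha.aestronglyMeasurable_exp _)
      (Eventually.of_forall fun x => ?_)
    rw [Real.norm_of_nonneg (mul_nonneg (Real.exp_pos _).le (ha.nonneg x)), ← mul_assoc]
    refine mul_le_mul_of_nonneg_right ?_ (ha.nonneg x)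
    have h3 := hf x
    simp only [f, hexp] at h3
    rw [sub_nonneg] at h3
    calc _ = Real.exp K * (Real.exp (-K) * Real.exp (inner ℝ ((1 - t) • γ₁ + t • γ₂) x)) := by
          rw [← mul_assoc, ← Real.exp_add]; simp
      _ ≤ _ := mul_le_mul_of_nonneg_left h3 (Real.exp_pos _).le
  have hmem := ha.mem_effDomain_iff.2 hm
  refine ⟨hmem, ?_⟩
  have hfa : ∀ x, f x * a x = ((1 - t) * Real.exp (inner ℝ γ₁ x - L₁) +
      t * Real.exp (inner ℝ γ₂ x - L₂)) * a x -
      Real.exp (-K) * (Real.exp (inner ℝ ((1 - t) • γ₁ + t • γ₂) x) * a x) := fun x => by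
    simp only [f, hexp]; ring
  have hpos : 0 < ∫ x, f x * a x := by
    refine ha.integral_mul_pos hf ?_ (sub_ne_zero.2 hne) (L₁ - L₂) fun x hx => ?_
    · simp only [hfa]; exact hsum.sub (hm.const_mul _)
    · by_contra hcon
      have hne' : inner ℝ γ₁ x - L₁ ≠ inner ℝ γ₂ x - L₂ := fun h => hcon (by
        rw [inner_sub_left]; linarith)
      have := exp_combo_lt hne' h0 h1
      simp only [f] at hx
      linarith
  simp only [hfa] at hpos
  rw [integral_sub hsum (hm.const_mul _), hsumv, integral_const_mul, ← ha.momentReal_eq] at hpos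
  have hp := ha.momentReal_pos hd hmem
  rw [logMoment, Real.log_lt_iff_lt_exp hp]
  have h5 : Real.exp (-K) * momentReal a ((1 - t) • γ₁ + t • γ₂) < 1 := by linarith
  rwa [Real.exp_neg, inv_mul_lt_iff₀ (Real.exp_pos _), mul_one] at h5

/-- Strict convexity of the exponential moment on its effective domain. -/
lemma IsKernel.momentReal_combo_lt (ha : IsKernel a) (hd : 1 ≤ d)
    {γ₁ γ₂ : EuclideanSpace ℝ (Fin d)} (h₁ : γ₁ ∈ effDomain a) (h₂ : γ₂ ∈ effDomain a)
    (hne : γ₁ ≠ γ₂) {t : ℝ} (h0 : 0 < t) (h1 : t < 1) :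
    (1 - t) • γ₁ + t • γ₂ ∈ effDomain a ∧
      momentReal a ((1 - t) • γ₁ + t • γ₂) <
        (1 - t) * momentReal a γ₁ + t * momentReal a γ₂ := by
  obtain ⟨hmem, hlt⟩ := ha.logMoment_combo_lt hd h₁ h₂ hne h0 h1
  refine ⟨hmem, ?_⟩
  have h3 := (Real.exp_lt_exp.2 hlt).trans_le (exp_combo_le h0 h1)
  simpa only [logMoment, Real.exp_log (ha.momentReal_pos hd hmem),
    Real.exp_log (ha.momentReal_pos hd h₁), Real.exp_log (ha.momentReal_pos hd h₂)] using h3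

/-- A coercive lower semicontinuous function attains its minimum. -/
lemma exists_forall_le_of_lowerSemicontinuous {f : EuclideanSpace ℝ (Fin d) → ENNReal}
    (hf : LowerSemicontinuous f) {R : ℝ} (hR : ∀ γ, R < ‖γ‖ → f 0 ≤ f γ) :
    ∃ γ₀, ∀ γ, f γ₀ ≤ f γ := by
  have h0 : (0 : EuclideanSpace ℝ (Fin d)) ∈ Metric.closedBall 0 (max R 0) := by simp
  obtain ⟨γ₀, -, hmin⟩ := LowerSemicontinuousOn.exists_isMinOn ⟨_, h0⟩
    (isCompact_closedBall (0 : EuclideanSpace ℝ (Fin d)) (max R 0)) (hf.lowerSemicontinuousOn _)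
  refine ⟨γ₀, fun γ => ?_⟩
  by_cases h : ‖γ‖ ≤ max R 0
  · exact hmin (by simpa using h)
  · exact (hmin h0).trans (hR γ ((le_max_left _ _).trans_lt (not_le.1 h)))

end NonlocalHeat

/-! ### Legendre duality: the rate function, the equation for `ξ`, and `Φ`. -/

namespace NonlocalHeat

variable {d : ℕ} {a : EuclideanSpace ℝ (Fin d) → ℝ}

lemma IsKernel.cumulant_eq (ha : IsKernel a) (hd : 1 ≤ d) {γ : EuclideanSpace ℝ (Fin d)}
    (hγ : γ ∈ effDomain a) : cumulant a γ = (logMoment a γ : EReal) :=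
  ENNReal.log_pos_real' (ha.momentReal_pos hd hγ)

lemma IsKernel.tilt_eq (ha : IsKernel a) (hd : 1 ≤ d) {γ : EuclideanSpace ℝ (Fin d)}
    (hγ : γ ∈ effDomain a) (r : EuclideanSpace ℝ (Fin d)) :
    expMoment a γ * ENNReal.ofReal (Real.exp (-inner ℝ γ r)) =
      ENNReal.ofReal (Real.exp (logMoment a γ - inner ℝ γ r)) := by
  rw [sub_eq_add_neg, Real.exp_add, logMoment, Real.exp_log (ha.momentReal_pos hd hγ),
    ENNReal.ofReal_mul (ha.momentReal_pos hd hγ).le, momentReal, ENNReal.ofReal_toReal hγ]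

lemma tilt_eq_top {γ : EuclideanSpace ℝ (Fin d)}
    (hγ : γ ∉ effDomain a) (r : EuclideanSpace ℝ (Fin d)) :
    expMoment a γ * ENNReal.ofReal (Real.exp (-inner ℝ γ r)) = ⊤ := by
  have : expMoment a γ = ⊤ := by simpa [effDomain] using hγ
  rw [this, ENNReal.top_mul]
  simpa using Real.exp_pos _

lemma IsKernel.rate_le_iff (ha : IsKernel a) (hd : 1 ≤ d) {r : EuclideanSpace ℝ (Fin d)} {c : ℝ} :
    rate a r ≤ (c : EReal) ↔ ∀ γ ∈ effDomain a, inner ℝ γ r - logMoment a γ ≤ c := by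
  rw [rate, iSup_le_iff]
  refine forall_congr' fun γ => ?_
  by_cases hγ : γ ∈ effDomain a
  · rw [ha.cumulant_eq hd hγ, ← EReal.coe_sub, EReal.coe_le_coe_iff]
    simp [hγ]
  · have : cumulant a γ = ⊤ := by
      rw [cumulant, ENNReal.log_eq_top_iff]
      simpa [effDomain] using hγ
    rw [this]
    simp [hγ]

lemma IsKernel.rate_ne_bot (ha : IsKernel a) (hd : 1 ≤ d) (r : EuclideanSpace ℝ (Fin d)) :
    rate a r ≠ ⊥ := by
  intro h
  have h1 : rate a r ≤ ((-1 : ℝ) : EReal) := h ▸ bot_le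
  have h2 := (ha.rate_le_iff hd).1 h1 0 ha.zero_mem_effDomain
  rw [logMoment, ha.momentReal_zero] at h2
  norm_num at h2

lemma IsKernel.le_rateReal (ha : IsKernel a) (hd : 1 ≤ d) {r γ : EuclideanSpace ℝ (Fin d)}
    (hr : rate a r ≠ ⊤) (hγ : γ ∈ effDomain a) : inner ℝ γ r - logMoment a γ ≤ rateReal a r := by
  refine (ha.rate_le_iff hd).1 ?_ γ hγ
  rw [rateReal, EReal.coe_toReal hr (ha.rate_ne_bot hd r)]

lemma IsKernel.rateReal_le (ha : IsKernel a) (hd : 1 ≤ d) {r : EuclideanSpace ℝ (Fin d)} {c : ℝ}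
    (h : ∀ γ ∈ effDomain a, inner ℝ γ r - logMoment a γ ≤ c) :
    rate a r ≠ ⊤ ∧ rateReal a r ≤ c := by
  have h1 := (ha.rate_le_iff hd).2 h
  refine ⟨(h1.trans_lt (EReal.coe_lt_top c)).ne, ?_⟩
  exact EReal.toReal_le_toReal h1 (ha.rate_ne_bot hd r) (EReal.coe_ne_top c)

/-- `γ₀` attains the supremum defining the rate function at `r`. -/
def IsLegendreMax (a : EuclideanSpace ℝ (Fin d) → ℝ) (r γ₀ : EuclideanSpace ℝ (Fin d)) : Prop :=
  γ₀ ∈ effDomain a ∧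
    ∀ γ ∈ effDomain a, inner ℝ γ r - logMoment a γ ≤ inner ℝ γ₀ r - logMoment a γ₀

/-- `γ₀` maximizes `γ · r - Λ(γ)`. -/
def IsMomentMax (a : EuclideanSpace ℝ (Fin d) → ℝ) (r γ₀ : EuclideanSpace ℝ (Fin d)) : Prop :=
  γ₀ ∈ effDomain a ∧
    ∀ γ ∈ effDomain a, inner ℝ γ r - momentReal a γ ≤ inner ℝ γ₀ r - momentReal a γ₀

lemma IsLegendreMax.rateReal_eq {r γ₀ : EuclideanSpace ℝ (Fin d)} (h : IsLegendreMax a r γ₀)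
    (ha : IsKernel a) (hd : 1 ≤ d) : rateReal a r = inner ℝ γ₀ r - logMoment a γ₀ := by
  obtain ⟨h1, h2⟩ := ha.rateReal_le hd h.2
  exact le_antisymm h2 (ha.le_rateReal hd h1 h.1)

lemma IsLegendreMax.lt {r γ₀ γ : EuclideanSpace ℝ (Fin d)} (h : IsLegendreMax a r γ₀)
    (ha : IsKernel a) (hd : 1 ≤ d) (hγ : γ ∈ effDomain a) (hne : γ ≠ γ₀) :
    inner ℝ γ r - logMoment a γ < inner ℝ γ₀ r - logMoment a γ₀ := by
  refine lt_of_le_of_ne (h.2 γ hγ) fun heq => ?_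
  obtain ⟨h1, h2⟩ := ha.logMoment_combo_lt hd hγ h.1 hne (t := 1 / 2) (by norm_num) (by norm_num)
  have h3 := h.2 _ h1
  rw [inner_add_left, real_inner_smul_left, real_inner_smul_left] at h3
  linarith

lemma IsMomentMax.unique {r γ₀ γ : EuclideanSpace ℝ (Fin d)} (h₀ : IsMomentMax a r γ₀)
    (h : IsMomentMax a r γ) (ha : IsKernel a) (hd : 1 ≤ d) : γ = γ₀ := by
  by_contra hne
  obtain ⟨h1, h2⟩ := ha.momentReal_combo_lt hd h.1 h₀.1 hne (t := 1 / 2) (by norm_num)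
    (by norm_num)
  have h3 := h.2 _ h1
  have h4 := h₀.2 _ h1
  rw [inner_add_left, real_inner_smul_left, real_inner_smul_left] at h3 h4
  linarith

/-- Away from the maximizer the concave functional `γ · r - L(γ)` drops at least linearly. -/
lemma IsLegendreMax.exists_linear_drop {r γ₀ : EuclideanSpace ℝ (Fin d)}
    (h : IsLegendreMax a r γ₀) (ha : IsKernel a) (hd : 1 ≤ d) {ε : ℝ} (hε : 0 < ε) :
    ∃ η > 0, ∀ γ ∈ effDomain a, ε ≤ ‖γ - γ₀‖ →
      inner ℝ γ r - logMoment a γ ≤ inner ℝ γ₀ r - logMoment a γ₀ - η * ‖γ - γ₀‖ := by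
  -- Uniqueness of the maximizer gives a strict drop at each point of the sphere; compactness and
  -- semicontinuity make the drop uniform.
  have hsphere : ∃ η > 0, ∀ γ ∈ effDomain a, ‖γ - γ₀‖ = ε →
      inner ℝ γ r - logMoment a γ ≤ inner ℝ γ₀ r - logMoment a γ₀ - η := by
    by_cases hne : (Metric.sphere γ₀ ε).Nonempty
    · obtain ⟨γ₁, hγ₁, hmin⟩ := LowerSemicontinuousOn.exists_isMinOn hne (isCompact_sphere γ₀ ε)
        ((lowerSemicontinuous_tilt ha r).lowerSemicontinuousOn _)
      by_cases h₁ : γ₁ ∈ effDomain a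
      · have hne₁ : γ₁ ≠ γ₀ := by
          rintro rfl
          rw [Metric.mem_sphere, dist_self] at hγ₁
          exact hε.ne hγ₁
        refine ⟨_, sub_pos.2 (h.lt ha hd h₁ hne₁), fun γ hγ hn => ?_⟩
        have h2 := isMinOn_iff.1 hmin γ (by simpa [dist_eq_norm] using hn)
        rw [ha.tilt_eq hd h₁, ha.tilt_eq hd hγ, ENNReal.ofReal_le_ofReal_iff (Real.exp_pos _).le,
          Real.exp_le_exp] at h2
        linarith
      · refine ⟨1, one_pos, fun γ hγ hn => ?_⟩
        have h2 := isMinOn_iff.1 hmin γ (by simpa [dist_eq_norm] using hn)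
        rw [tilt_eq_top h₁, ha.tilt_eq hd hγ, top_le_iff] at h2
        exact absurd h2 ENNReal.ofReal_ne_top
    · refine ⟨1, one_pos, fun γ _ hn => absurd ⟨γ, ?_⟩ hne⟩
      simpa [dist_eq_norm] using hn
  obtain ⟨η, hη, hs⟩ := hsphere
  refine ⟨η / ε, div_pos hη hε, fun γ hγ hn => ?_⟩
  rcases hn.eq_or_lt with heq | hlt
  · rw [← heq, div_mul_cancel₀ _ hε.ne']
    exact hs γ hγ heq.symm
  · have hpos := hε.trans hlt
    have hne : γ₀ ≠ γ := by rintro rfl; simp at hpos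
    -- The segment from `γ₀` to `γ` meets the sphere at parameter `t`, and concavity propagates the
    -- drop outward linearly.
    set t := ε / ‖γ - γ₀‖ with ht
    have ht0 : 0 < t := div_pos hε hpos
    have ht1 : t < 1 := (div_lt_one hpos).2 hlt
    obtain ⟨h1, h2⟩ := ha.logMoment_combo_lt hd h.1 hγ hne ht0 ht1
    have h3 := hs _ h1 (by
      rw [show (1 - t) • γ₀ + t • γ - γ₀ = t • (γ - γ₀) by module, norm_smul,
        Real.norm_of_nonneg ht0.le, ht, div_mul_cancel₀ _ hpos.ne'])
    rw [inner_add_left, real_inner_smul_left, real_inner_smul_left] at h3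
    have h4 : t * (inner ℝ γ r - logMoment a γ) ≤
        t * (inner ℝ γ₀ r - logMoment a γ₀ - η / ε * ‖γ - γ₀‖) := by
      have h5 : t * (η / ε * ‖γ - γ₀‖) = η := by
        rw [ht]; field_simp
      nlinarith
    exact le_of_mul_le_mul_left h4 ht0

/-- Where the supremum is attained, the rate function is finite nearby and differentiable, and the
maximizer is its gradient. -/
lemma IsLegendreMax.hasGradientAt {r γ₀ : EuclideanSpace ℝ (Fin d)} (h : IsLegendreMax a r γ₀)
    (ha : IsKernel a) (hd : 1 ≤ d) :
    (∀ᶠ y in 𝓝 r, rate a y ≠ ⊤) ∧ HasGradientAt (rateReal a) γ₀ r := by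
  have key : ∀ ε > 0, ∀ᶠ y in 𝓝 r, rate a y ≠ ⊤ ∧
      rateReal a y ≤ inner ℝ γ₀ r - logMoment a γ₀ + inner ℝ γ₀ (y - r) + ε * ‖y - r‖ := by
    intro ε hε
    obtain ⟨η, hη, hdrop⟩ := h.exists_linear_drop ha hd hε
    filter_upwards [Metric.closedBall_mem_nhds r hη] with y hy
    have hyn : ‖y - r‖ ≤ η := by simpa [dist_eq_norm] using hy
    refine ha.rateReal_le hd fun γ hγ => ?_
    have h1 : inner ℝ γ y = inner ℝ γ r + inner ℝ γ₀ (y - r) + (inner ℝ (γ - γ₀) (y - r) : ℝ) := by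
      rw [inner_sub_left, inner_sub_right, inner_sub_right]; ring
    have h2 := real_inner_le_norm (γ - γ₀) (y - r)
    -- Far from `γ₀` the linear drop `η ‖γ - γ₀‖` absorbs the perturbation since `‖y - r‖ ≤ η`; near
    -- `γ₀` the perturbation is at most `ε ‖y - r‖`.
    rcases le_total ε ‖γ - γ₀‖ with hc | hc
    · have h3 := hdrop γ hγ hc
      have h4 := mul_le_mul_of_nonneg_left hyn (norm_nonneg (γ - γ₀))
      have h5 := mul_nonneg hε.le (norm_nonneg (y - r))
      linarith
    · have h3 := h.2 γ hγ
      have h4 := mul_le_mul_of_nonneg_right hc (norm_nonneg (y - r))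
      linarith
  refine ⟨(key 1 one_pos).mono fun y hy => hy.1, ?_⟩
  rw [hasGradientAt_iff_isLittleO, isLittleO_iff]
  intro ε hε
  filter_upwards [key ε hε] with y hy
  have h1 := ha.le_rateReal hd hy.1 h.1
  have h2 : inner ℝ γ₀ y = inner ℝ γ₀ r + (inner ℝ γ₀ (y - r) : ℝ) := by
    rw [inner_sub_right]; ring
  rw [h.rateReal_eq ha hd, Real.norm_of_nonneg (by linarith)]
  linarith [hy.2]

/-- The supremum defining the rate function is attained at interior points of its domain. -/
lemma IsRadial.exists_isLegendreMax (hrad : IsRadial a) (ha : IsKernel a) (hd : 1 ≤ d)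
    {r : EuclideanSpace ℝ (Fin d)} (hr : r ≠ 0) (hfin : ∀ᶠ y in 𝓝 r, rate a y ≠ ⊤) :
    ∃ γ₀, IsLegendreMax a r γ₀ := by
  have hrn : 0 < ‖r‖ := norm_pos_iff.2 hr
  -- Finiteness slightly beyond `r` on its ray gives coercivity: testing the rate at `(1 + δ) r`
  -- with `γ` rotated to the direction of `r` leaves a surplus `δ ‖r‖ ‖γ‖`.
  obtain ⟨δ, hδ, hδfin⟩ : ∃ δ : ℝ, 0 < δ ∧ rate a ((1 + δ) • r) ≠ ⊤ := by
    have hc : Tendsto (fun δ : ℝ => (1 + δ) • r) (𝓝[>] 0) (𝓝 r) := by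
      have : Continuous fun δ : ℝ => (1 + δ) • r := by fun_prop
      simpa using (this.tendsto 0).mono_left nhdsWithin_le_nhds
    obtain ⟨δ, h1, h2⟩ := ((hc.eventually hfin).and self_mem_nhdsWithin).exists
    exact ⟨δ, h2, h1⟩
  set K := rateReal a ((1 + δ) • r) with hK
  have hcoer : ∀ γ ∈ effDomain a, δ * ‖r‖ * ‖γ‖ - K ≤ logMoment a γ - inner ℝ γ r := by
    intro γ hγ
    have hn : ‖γ‖ = ‖(‖γ‖ / ‖r‖) • r‖ := by
      rw [norm_smul, Real.norm_of_nonneg (by positivity), div_mul_cancel₀ _ hrn.ne']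
    have h1 := ha.le_rateReal hd hδfin ((hrad.mem_effDomain_congr hn).1 hγ)
    rw [logMoment, ← hrad.momentReal_eq_of_norm_eq hn, ← logMoment, real_inner_smul_left,
      inner_smul_right, real_inner_self_eq_norm_sq, ← hK] at h1
    have h2 : ‖γ‖ / ‖r‖ * ((1 + δ) * ‖r‖ ^ 2) = ‖γ‖ * ‖r‖ + δ * ‖r‖ * ‖γ‖ := by
      field_simp
    have h3 := real_inner_le_norm γ r
    linarith
  have hzero : expMoment a 0 * ENNReal.ofReal (Real.exp (-inner ℝ 0 r)) = 1 := by
    rw [ha.tilt_eq hd ha.zero_mem_effDomain, logMoment, ha.momentReal_zero]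
    simp
  obtain ⟨γ₀, hγ₀⟩ := exists_forall_le_of_lowerSemicontinuous (lowerSemicontinuous_tilt ha r)
    (R := K / (δ * ‖r‖)) (fun γ hγ => by
      rw [hzero]
      by_cases hm : γ ∈ effDomain a
      · rw [ha.tilt_eq hd hm, ENNReal.one_le_ofReal, Real.one_le_exp_iff]
        refine le_trans ?_ (hcoer γ hm)
        rw [div_lt_iff₀ (by positivity)] at hγ
        linarith
      · rw [tilt_eq_top hm]; exact le_top)
  have hm₀ : γ₀ ∈ effDomain a := by
    by_contra hm
    have := hγ₀ 0
    rw [tilt_eq_top hm, hzero] at this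
    simp at this
  refine ⟨γ₀, hm₀, fun γ hγ => ?_⟩
  have h1 := hγ₀ γ
  rw [ha.tilt_eq hd hm₀, ha.tilt_eq hd hγ, ENNReal.ofReal_le_ofReal_iff (Real.exp_pos _).le,
    Real.exp_le_exp] at h1
  linarith

/-- Exponentiating `L(γ) ≥ L(γ₀) + u`, with `u = ξ (γ - γ₀) · r`, and using `e^u ≥ 1 + u` gives the
supporting hyperplane of `Λ` at `γ₀`, because `ξ Λ(γ₀) = 1`. -/
lemma IsLegendreMax.isMomentMax {r γ₀ : EuclideanSpace ℝ (Fin d)} {ξ : ℝ}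
    (h : IsLegendreMax a (ξ • r) γ₀) (ha : IsKernel a) (hd : 1 ≤ d) (hξ : 0 < ξ)
    (hlog : Real.log ξ = -logMoment a γ₀) : IsMomentMax a r γ₀ ∧ ξ = (momentReal a γ₀)⁻¹ := by
  have hp := ha.momentReal_pos hd h.1
  have hξ' : ξ = (momentReal a γ₀)⁻¹ := by
    rw [logMoment, ← Real.log_inv] at hlog
    exact Real.log_injOn_pos hξ (inv_pos.2 hp) hlog
  refine ⟨⟨h.1, fun γ hγ => ?_⟩, hξ'⟩
  have h1 := h.2 γ hγ
  rw [inner_smul_right, inner_smul_right] at h1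
  set u := ξ * (inner ℝ γ r) - ξ * (inner ℝ γ₀ r : ℝ) with hu
  have h2 : Real.exp (logMoment a γ₀ + u) ≤ Real.exp (logMoment a γ) :=
    Real.exp_le_exp.2 (by linarith)
  rw [Real.exp_add, logMoment, logMoment, Real.exp_log hp,
    Real.exp_log (ha.momentReal_pos hd hγ)] at h2
  have h3 := mul_le_mul_of_nonneg_left (Real.add_one_le_exp u) hp.le
  have h4 : momentReal a γ₀ * u = inner ℝ γ r - inner ℝ γ₀ r := by
    rw [hu, hξ']; field_simp
  linarith

lemma le_of_forall_one_add_le_exp {D q : ℝ}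
    (h : ∀ t : ℝ, 0 < t → t < 1 → 1 + t * q ≤ Real.exp (t * D)) : q ≤ D := by
  have hd : HasDerivAt (fun t : ℝ => Real.exp (t * D)) D 0 := by
    have := ((hasDerivAt_id (0 : ℝ)).mul_const D).exp
    simpa using this
  have ht := hd.tendsto_slope_zero_right
  refine ge_of_tendsto ht ?_
  filter_upwards [Ioo_mem_nhdsGT (show (0 : ℝ) < 1 by norm_num)] with t ht'
  have h1 := h t ht'.1 ht'.2
  simp only [zero_add, zero_mul, Real.exp_zero, smul_eq_mul]
  rw [inv_mul_eq_div, le_div_iff₀ ht'.1]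
  linarith

/-- Along the segment from `γ₀` to `γ`, maximality bounds `Λ` below by an affine function of `t` and
log-convexity bounds it above by `Λ(γ₀) e^{tD}`, `D = L(γ) - L(γ₀)`. Comparing slopes at `t = 0+`
suffices, with no derivative of `Λ`. -/
lemma IsMomentMax.isLegendreMax {r γ₀ : EuclideanSpace ℝ (Fin d)}
    (h : IsMomentMax a r γ₀) (ha : IsKernel a) (hd : 1 ≤ d) :
    IsLegendreMax a ((momentReal a γ₀)⁻¹ • r) γ₀ := by
  have hp := ha.momentReal_pos hd h.1
  refine ⟨h.1, fun γ hγ => ?_⟩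
  rcases eq_or_ne γ₀ γ with rfl | hne
  · exact le_rfl
  have key : (momentReal a γ₀)⁻¹ * (inner ℝ γ r - inner ℝ γ₀ r) ≤
      logMoment a γ - logMoment a γ₀ := by
    refine le_of_forall_one_add_le_exp fun t ht0 ht1 => ?_
    obtain ⟨h1, h2⟩ := ha.logMoment_combo_lt hd h.1 hγ hne ht0 ht1
    have h3 := h.2 _ h1
    rw [inner_add_left, real_inner_smul_left, real_inner_smul_left] at h3
    have h4 := Real.exp_lt_exp.2 h2
    rw [show (1 - t) * logMoment a γ₀ + t * logMoment a γ =
      logMoment a γ₀ + t * (logMoment a γ - logMoment a γ₀) by ring, Real.exp_add,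
      logMoment, logMoment, Real.exp_log (ha.momentReal_pos hd h1), Real.exp_log hp,
      ← logMoment] at h4
    refine le_of_mul_le_mul_left ?_ hp
    have h5 : momentReal a γ₀ * (1 + t * ((momentReal a γ₀)⁻¹ *
        (inner ℝ γ r - inner ℝ γ₀ r))) =
        momentReal a γ₀ + t * (inner ℝ γ r - inner ℝ γ₀ r) := by
      field_simp
    rw [h5]
    linarith
  rw [inner_smul_right, inner_smul_right]
  linarith

lemma IsMomentMax.isXi {r γ₀ : EuclideanSpace ℝ (Fin d)} (h : IsMomentMax a r γ₀)
    (ha : IsKernel a) (hd : 1 ≤ d) : IsXi a r (momentReal a γ₀)⁻¹ := by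
  have hp := ha.momentReal_pos hd h.1
  have hL := h.isLegendreMax ha hd
  obtain ⟨h1, h2⟩ := hL.hasGradientAt ha hd
  refine ⟨inv_pos.2 hp, h1, h2.differentiableAt, ?_⟩
  rw [h2.gradient, hL.rateReal_eq ha hd, real_inner_comm, logMoment, Real.log_inv]
  ring

lemma IsXi.exists_isMomentMax {r : EuclideanSpace ℝ (Fin d)} {ξ : ℝ} (h : IsXi a r ξ)
    (hr : r ≠ 0) (ha : IsKernel a) (hrad : IsRadial a) (hd : 1 ≤ d) :
    ∃ γ₀, IsMomentMax a r γ₀ ∧ ξ = (momentReal a γ₀)⁻¹ := by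
  obtain ⟨hξ, hfin, -, hlog⟩ := h
  obtain ⟨γ₀, hγ₀⟩ := hrad.exists_isLegendreMax ha hd (smul_ne_zero hξ.ne' hr) hfin
  refine ⟨γ₀, hγ₀.isMomentMax ha hd hξ ?_⟩
  rw [hlog, (hγ₀.hasGradientAt ha hd).2.gradient, hγ₀.rateReal_eq ha hd, real_inner_comm]
  ring

lemma IsMomentMax.existsUnique_isXi {r γ₀ : EuclideanSpace ℝ (Fin d)} (h : IsMomentMax a r γ₀)
    (hr : r ≠ 0) (ha : IsKernel a) (hrad : IsRadial a) (hd : 1 ≤ d) :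
    ∃! ξ : ℝ, IsXi a r ξ := by
  refine ⟨_, h.isXi ha hd, fun ξ hξ => ?_⟩
  obtain ⟨γ, hγ, rfl⟩ := hξ.exists_isMomentMax hr ha hrad hd
  rw [h.unique hγ ha hd]

/-- `Φ(r)` is the Legendre transform of `Λ - 1`. -/
lemma IsMomentMax.phi_eq {r γ₀ : EuclideanSpace ℝ (Fin d)} (h : IsMomentMax a r γ₀)
    (hr : r ≠ 0) (ha : IsKernel a) (hrad : IsRadial a) (hd : 1 ≤ d) :
    Phi a r = inner ℝ γ₀ r - momentReal a γ₀ + 1 := by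
  have hp := ha.momentReal_pos hd h.1
  have hxi : xi a r = (momentReal a γ₀)⁻¹ :=
    (h.existsUnique_isXi hr ha hrad hd).unique (Classical.epsilon_spec ⟨_, h.isXi ha hd⟩)
      (h.isXi ha hd)
  rw [Phi, hxi, (h.isLegendreMax ha hd).rateReal_eq ha hd, Real.log_inv, ← logMoment,
    inner_smul_right]
  field_simp
  ring

end NonlocalHeat

/-! ### Second moments, existence of maximizers, reduction to one variable. -/

namespace NonlocalHeat

variable {d : ℕ} {a : EuclideanSpace ℝ (Fin d) → ℝ}

lemma two_add_sq_le_exp_add_exp_neg (u : ℝ) : 2 + u ^ 2 ≤ Real.exp u + Real.exp (-u) := by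
  have h1 : Real.cosh u = 1 + 2 * Real.sinh (u / 2) ^ 2 := by
    have h := Real.cosh_two_mul (u / 2)
    rw [Real.cosh_sq, mul_div_cancel₀ u two_ne_zero] at h
    linarith
  have h2 : (u / 2) ^ 2 ≤ Real.sinh (u / 2) ^ 2 := by
    rw [sq_le_sq]
    rcases le_total 0 (u / 2) with h | h
    · rw [abs_of_nonneg h, abs_of_nonneg (Real.sinh_nonneg_iff.2 h)]
      exact Real.self_le_sinh_iff.2 h
    · rw [abs_of_nonpos h, abs_of_nonpos (Real.sinh_nonpos_iff.2 h)]
      exact neg_le_neg (Real.sinh_le_self_iff.2 h)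
  have h3 := Real.cosh_eq u
  nlinarith

lemma IsKernel.integrable_inner_sq (ha : IsKernel a) (v : EuclideanSpace ℝ (Fin d)) :
    Integrable (fun x => (inner ℝ v x : ℝ) ^ 2 * a x) volume := by
  refine (ha.integrable_sq.const_mul (‖v‖ ^ 2)).mono'
    (ha.aestronglyMeasurable_mul (by fun_prop)) (Eventually.of_forall fun x => ?_)
  rw [Real.norm_of_nonneg (mul_nonneg (sq_nonneg _) (ha.nonneg x)), ← mul_assoc, ← mul_pow]
  refine mul_le_mul_of_nonneg_right ?_ (ha.nonneg x)
  rw [← sq_abs]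
  exact pow_le_pow_left₀ (abs_nonneg _) (abs_real_inner_le_norm v x) 2

/-- The second moment of `X · e`. -/
noncomputable def dirVariance (a : EuclideanSpace ℝ (Fin d) → ℝ)
    (e : EuclideanSpace ℝ (Fin d)) : ℝ :=
  ∫ x, (inner ℝ e x : ℝ) ^ 2 * a x

lemma IsRadial.dirVariance_eq (hrad : IsRadial a) {e : EuclideanSpace ℝ (Fin d)} (he : ‖e‖ = 1)
    (v : EuclideanSpace ℝ (Fin d)) : dirVariance a v = ‖v‖ ^ 2 * dirVariance a e := by
  have h := hrad.integral_inner_eq (fun u => u ^ 2) (u := v) (v := ‖v‖ • e)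
    (by rw [norm_smul, he]; simp)
  rw [dirVariance, h, dirVariance, ← integral_const_mul]
  refine integral_congr_ae (Eventually.of_forall fun x => ?_)
  simp only [real_inner_smul_left]
  ring

lemma IsKernel.dirVariance_pos (ha : IsKernel a) {e : EuclideanSpace ℝ (Fin d)} (he : ‖e‖ = 1) :
    0 < dirVariance a e := by
  refine ha.integral_mul_pos (fun x => sq_nonneg _) (ha.integrable_inner_sq e)
    (δ := e) ?_ 0 fun x hx => by simpa using hx
  rintro rfl
  simp at he

lemma IsKernel.covMatrix_eq (ha : IsKernel a) (hrad : IsRadial a)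
    {e : EuclideanSpace ℝ (Fin d)} (he : ‖e‖ = 1) :
    covMatrix a = dirVariance a e • (1 : Matrix (Fin d) (Fin d) ℝ) := by
  ext i j
  set u := EuclideanSpace.single i (1 : ℝ) with hu
  set v := EuclideanSpace.single j (1 : ℝ) with hv
  -- Polarization: the variance form of a radial kernel is a multiple of `‖v‖ ^ 2`, which determines
  -- the whole matrix.
  have h1 : ∀ x : EuclideanSpace ℝ (Fin d), x i * x j * a x =
      4⁻¹ * ((inner ℝ (u + v) x : ℝ) ^ 2 * a x - (inner ℝ (u - v) x : ℝ) ^ 2 * a x) := fun x => by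
    have hi : (inner ℝ u x : ℝ) = x i := by simp [hu, EuclideanSpace.inner_single_left]
    have hj : (inner ℝ v x : ℝ) = x j := by simp [hv, EuclideanSpace.inner_single_left]
    rw [inner_add_left, inner_sub_left, hi, hj]
    ring
  have h2 : (inner ℝ u v : ℝ) = (1 : Matrix (Fin d) (Fin d) ℝ) i j := by
    rw [Matrix.one_apply, hu, hv, EuclideanSpace.inner_single_left]
    simp
  rw [covMatrix, Matrix.of_apply]
  simp only [h1]
  rw [integral_const_mul, integral_sub (ha.integrable_inner_sq _) (ha.integrable_inner_sq _),
    ← dirVariance, ← dirVariance, hrad.dirVariance_eq he (u + v), hrad.dirVariance_eq he (u - v),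
    norm_add_sq_real, norm_sub_sq_real, h2, Matrix.smul_apply, smul_eq_mul]
  ring

/-- By symmetry `e^{γ·x}` may be averaged with `e^{-γ·x}`, and `cosh u ≥ 1 + u²/2`. This quadratic
growth is the coercivity that yields maximizers. -/
lemma IsRadial.one_add_sq_le_momentReal (hrad : IsRadial a) (ha : IsKernel a)
    {e : EuclideanSpace ℝ (Fin d)} (he : ‖e‖ = 1) {γ : EuclideanSpace ℝ (Fin d)}
    (hγ : γ ∈ effDomain a) : 1 + dirVariance a e / 2 * ‖γ‖ ^ 2 ≤ momentReal a γ := by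
  have hi := ha.mem_effDomain_iff.1 hγ
  have hi' := ha.mem_effDomain_iff.1 ((hrad.mem_effDomain_congr (norm_neg γ)).2 hγ)
  have h1 : ∫ x, (2 * a x + (inner ℝ γ x : ℝ) ^ 2 * a x) ≤
      ∫ x, (Real.exp (inner ℝ γ x) * a x + Real.exp (inner ℝ (-γ) x) * a x) := by
    refine integral_mono ((ha.integrable.const_mul 2).add (ha.integrable_inner_sq γ))
      (hi.add hi') fun x => ?_
    have := mul_le_mul_of_nonneg_right (two_add_sq_le_exp_add_exp_neg (inner ℝ γ x)) (ha.nonneg x)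
    simp only [inner_neg_left]
    linarith
  rw [integral_add (ha.integrable.const_mul 2) (ha.integrable_inner_sq γ), integral_add hi hi',
    integral_const_mul, ha.integral_eq_one, ← ha.momentReal_eq, ← ha.momentReal_eq,
    hrad.momentReal_eq_of_norm_eq (norm_neg γ), ← dirVariance, hrad.dirVariance_eq he γ] at h1
  linarith

lemma IsRadial.one_le_momentReal (hrad : IsRadial a) (ha : IsKernel a)
    {e : EuclideanSpace ℝ (Fin d)} (he : ‖e‖ = 1) {γ : EuclideanSpace ℝ (Fin d)}
    (hγ : γ ∈ effDomain a) : 1 ≤ momentReal a γ := by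
  have h1 := hrad.one_add_sq_le_momentReal ha he hγ
  have h2 := ha.dirVariance_pos he
  have : 0 ≤ dirVariance a e / 2 * ‖γ‖ ^ 2 := by positivity
  linarith

lemma IsRadial.exists_isMomentMax (hrad : IsRadial a) (ha : IsKernel a)
    {e : EuclideanSpace ℝ (Fin d)} (he : ‖e‖ = 1) (r : EuclideanSpace ℝ (Fin d)) :
    ∃ γ₀, IsMomentMax a r γ₀ := by
  have hσ := ha.dirVariance_pos he
  set σ := dirVariance a e
  set R := 2 * ‖r‖ / σ with hR
  have hR0 : 0 ≤ R := by positivity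
  have hRσ : σ / 2 * R = ‖r‖ := by rw [hR]; field_simp
  -- The function `Λ(γ) - γ · r` shifted by `R ‖r‖`, so that for `‖γ‖ ≤ R` the truncation in
  -- `ofReal` is inactive. Outside that ball the quadratic growth of `Λ` suffices.
  let f : EuclideanSpace ℝ (Fin d) → ENNReal := fun γ =>
    expMoment a γ + ENNReal.ofReal (R * ‖r‖ - inner ℝ γ r)
  have hf : LowerSemicontinuous f := by
    refine (lowerSemicontinuous_expMoment ha).add (Continuous.lowerSemicontinuous ?_)
    exact ENNReal.continuous_ofReal.comp (by fun_prop)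
  have hf0 : f 0 = ENNReal.ofReal (1 + R * ‖r‖) := by
    have h1 : expMoment a 0 = ENNReal.ofReal 1 := by
      rw [← ha.momentReal_zero, momentReal, ENNReal.ofReal_toReal ha.zero_mem_effDomain]
    simp only [f, inner_zero_left, sub_zero]
    rw [h1, ENNReal.ofReal_add zero_le_one (by positivity)]
  have hval : ∀ γ ∈ effDomain a, f γ = ENNReal.ofReal (momentReal a γ) +
      ENNReal.ofReal (R * ‖r‖ - inner ℝ γ r) := fun γ hγ => by
    simp only [f, momentReal, ENNReal.ofReal_toReal hγ]
  have hlarge : ∀ γ ∈ effDomain a, R < ‖γ‖ → 1 + R * ‖r‖ ≤ momentReal a γ ∧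
      1 ≤ momentReal a γ - inner ℝ γ r := fun γ hγ hn => by
    have h1 := hrad.one_add_sq_le_momentReal ha he hγ
    have h2 := real_inner_le_norm γ r
    have h3 : ‖γ‖ * ‖r‖ ≤ σ / 2 * ‖γ‖ ^ 2 := by
      rw [← hRσ, sq]
      nlinarith [mul_nonneg (mul_nonneg hσ.le (norm_nonneg γ)) (sub_nonneg.2 hn.le)]
    have h4 := mul_le_mul_of_nonneg_right hn.le (norm_nonneg r)
    constructor <;> linarith
  obtain ⟨γ₀, hγ₀⟩ := exists_forall_le_of_lowerSemicontinuous hf (R := R) fun γ hn => by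
    by_cases hγ : γ ∈ effDomain a
    · rw [hf0, hval γ hγ]
      exact (ENNReal.ofReal_le_ofReal (hlarge γ hγ hn).1).trans le_self_add
    · have : expMoment a γ = ⊤ := by simpa [effDomain] using hγ
      simp only [f, this, top_add, le_top]
  have hm₀ : γ₀ ∈ effDomain a := by
    by_contra hm
    have h1 : expMoment a γ₀ = ⊤ := by simpa [effDomain] using hm
    have h2 := hγ₀ 0
    rw [hf0] at h2
    simp only [f, h1, top_add, top_le_iff] at h2
    exact ENNReal.ofReal_ne_top h2
  have hsmall : ∀ γ ∈ effDomain a, ‖γ‖ ≤ R →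
      momentReal a γ₀ - inner ℝ γ₀ r ≤ momentReal a γ - inner ℝ γ r := fun γ hγ hn => by
    have h1 := hγ₀ γ
    have h2 : (inner ℝ γ r : ℝ) ≤ R * ‖r‖ :=
      (real_inner_le_norm γ r).trans (mul_le_mul_of_nonneg_right hn (norm_nonneg r))
    have hM : 0 ≤ momentReal a γ := ENNReal.toReal_nonneg
    rw [hval γ hγ, hval γ₀ hm₀, ← ENNReal.ofReal_add hM (sub_nonneg.2 h2)] at h1
    have h3 := ENNReal.ofReal_add_le.trans h1
    rw [ENNReal.ofReal_le_ofReal_iff (add_nonneg hM (sub_nonneg.2 h2))] at h3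
    linarith
  refine ⟨γ₀, hm₀, fun γ hγ => ?_⟩
  rcases le_or_gt ‖γ‖ R with hn | hn
  · linarith [hsmall γ hγ hn]
  · have h1 := hsmall 0 ha.zero_mem_effDomain (by simpa using hR0)
    rw [ha.momentReal_zero, inner_zero_left] at h1
    linarith [(hlarge γ hγ hn).2]

lemma IsRadial.mem_effDomain_norm_smul (hrad : IsRadial a) {e γ : EuclideanSpace ℝ (Fin d)}
    (he : ‖e‖ = 1) (hγ : γ ∈ effDomain a) :
    ‖γ‖ • e ∈ effDomain a ∧ momentReal a (‖γ‖ • e) = momentReal a γ := by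
  have hn : ‖γ‖ = ‖‖γ‖ • e‖ := by rw [norm_smul, he]; simp
  exact ⟨(hrad.mem_effDomain_congr hn).1 hγ, (hrad.momentReal_eq_of_norm_eq hn).symm⟩

/-- Scalar form of the Legendre formula for `Φ`. -/
lemma IsRadial.phi_isGreatest (hrad : IsRadial a) (ha : IsKernel a) (hd : 1 ≤ d)
    {e r : EuclideanSpace ℝ (Fin d)} (he : ‖e‖ = 1) (hr : r ≠ 0) :
    IsGreatest {y | ∃ l : ℝ, 0 ≤ l ∧ l • e ∈ effDomain a ∧
      y = l * ‖r‖ - momentReal a (l • e) + 1} (Phi a r) := by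
  obtain ⟨γ₀, hγ₀⟩ := hrad.exists_isMomentMax ha he r
  have hphi := hγ₀.phi_eq hr ha hrad hd
  have hub : ∀ l : ℝ, 0 ≤ l → l • e ∈ effDomain a →
      l * ‖r‖ - momentReal a (l • e) + 1 ≤ Phi a r := by
    intro l hl hm
    have hrn : 0 < ‖r‖ := norm_pos_iff.2 hr
    have hn : ‖l • e‖ = ‖(l / ‖r‖) • r‖ := by
      rw [norm_smul, norm_smul, he, Real.norm_of_nonneg hl,
        Real.norm_of_nonneg (div_nonneg hl hrn.le), div_mul_cancel₀ _ hrn.ne', mul_one]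
    have h1 := hγ₀.2 _ ((hrad.mem_effDomain_congr hn).1 hm)
    rw [← hrad.momentReal_eq_of_norm_eq hn, real_inner_smul_left,
      real_inner_self_eq_norm_sq, show l / ‖r‖ * ‖r‖ ^ 2 = l * ‖r‖ by field_simp] at h1
    linarith
  refine ⟨⟨‖γ₀‖, norm_nonneg _, (hrad.mem_effDomain_norm_smul he hγ₀.1).1, ?_⟩, ?_⟩
  · obtain ⟨h1, h2⟩ := hrad.mem_effDomain_norm_smul he hγ₀.1
    refine le_antisymm ?_ (hub _ (norm_nonneg _) h1)
    rw [h2, hphi]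
    linarith [real_inner_le_norm γ₀ r]
  · rintro y ⟨l, hl, hm, rfl⟩
    exact hub l hl hm

lemma IsRadial.phi_eq_of_norm (hrad : IsRadial a) (ha : IsKernel a) (hd : 1 ≤ d)
    {e : EuclideanSpace ℝ (Fin d)} (he : ‖e‖ = 1) (r : EuclideanSpace ℝ (Fin d)) :
    Phi a r = Phi a (‖r‖ • e) := by
  rcases eq_or_ne r 0 with rfl | hr
  · simp
  · have hne : ‖r‖ • e ≠ 0 := by
      rw [← norm_ne_zero_iff, norm_smul, he]
      simpa using hr
    have h1 := hrad.phi_isGreatest ha hd he hr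
    have h2 := hrad.phi_isGreatest ha hd he hne
    rw [norm_smul, he, norm_norm, mul_one] at h2
    exact h1.unique h2

/-- The Legendre transform `φ(s) = max_l (l s - Λ(l e) + 1)`. -/
lemma IsRadial.phi_smul_isGreatest (hrad : IsRadial a) (ha : IsKernel a) (hd : 1 ≤ d)
    {e : EuclideanSpace ℝ (Fin d)} (he : ‖e‖ = 1) {s : ℝ} (hs : 0 < s) :
    IsGreatest {y | ∃ l : ℝ, 0 ≤ l ∧ l • e ∈ effDomain a ∧
      y = l * s - momentReal a (l • e) + 1} (Phi a (s • e)) := by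
  have hne : s • e ≠ 0 := by
    rw [← norm_ne_zero_iff, norm_smul, he]
    simpa using hs.ne'
  have h := hrad.phi_isGreatest ha hd he hne
  rwa [norm_smul, he, Real.norm_of_nonneg hs.le, mul_one] at h

end NonlocalHeat

/-! ### Light tails, convolution powers and the Chernoff bound. -/

namespace NonlocalHeat

variable {d : ℕ} {a : EuclideanSpace ℝ (Fin d) → ℝ} {b p : ℝ}

lemma integrable_exp_neg_mul_norm {δ : ℝ} (hδ : 0 < δ) :
    Integrable (fun x : EuclideanSpace ℝ (Fin d) => Real.exp (-δ * ‖x‖)) volume := by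
  have h1 : Integrable (fun x : EuclideanSpace ℝ (Fin d) => (1 + ‖x‖) ^ (-((d + 1 : ℕ) : ℝ)))
      volume := integrable_one_add_norm (by simp)
  have hm : AEStronglyMeasurable (fun x : EuclideanSpace ℝ (Fin d) => Real.exp (-δ * ‖x‖))
      volume := Continuous.aestronglyMeasurable (by fun_prop)
  refine (h1.const_mul ((d + 1).factorial / δ ^ (d + 1) * Real.exp δ)).mono' hm
    (Eventually.of_forall fun x => ?_)
  have hx : 0 < 1 + ‖x‖ := by positivity
  rw [Real.norm_of_nonneg (Real.exp_pos _).le, Real.rpow_neg hx.le, Real.rpow_natCast]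
  have h2 := Real.pow_div_factorial_le_exp (δ * (1 + ‖x‖)) (by positivity) (d + 1)
  rw [mul_pow, div_le_iff₀ (by positivity), mul_add, mul_one, Real.exp_add] at h2
  rw [neg_mul, Real.exp_neg, ← div_eq_mul_inv, le_div_iff₀ (by positivity),
    inv_mul_le_iff₀ (Real.exp_pos _), div_mul_eq_mul_div, mul_div_assoc', le_div_iff₀ (by positivity)]
  linarith

/-- The power `b ρ ^ p` dominates linear functions. -/
lemma exists_linear_le_rpow (hb : 0 < b) (hp : 1 ≤ p) {c : ℝ} (hc : p = 1 → c ≤ b) :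
    ∃ K : ℝ, ∀ ρ : ℝ, 0 ≤ ρ → c * ρ ≤ K + b * ρ ^ p := by
  rcases hp.eq_or_lt with rfl | hp1
  · refine ⟨0, fun ρ hρ => ?_⟩
    rw [Real.rpow_one, zero_add]
    exact mul_le_mul_of_nonneg_right (hc rfl) hρ
  -- Beyond this radius `b ρ ^ (p - 1) ≥ |c|`.
  · set R := (|c| / b) ^ (1 / (p - 1)) with hR
    have hR0 : 0 ≤ R := by positivity
    have hp0 : 0 < p - 1 := by linarith
    refine ⟨|c| * R, fun ρ hρ => ?_⟩
    have hρp : 0 ≤ ρ ^ p := Real.rpow_nonneg hρ _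
    have h1 : c * ρ ≤ |c| * ρ := mul_le_mul_of_nonneg_right (le_abs_self c) hρ
    rcases le_total ρ R with h | h
    · have := mul_le_mul_of_nonneg_left h (abs_nonneg c)
      have := mul_nonneg hb.le hρp
      linarith
    · have h2 : |c| / b ≤ ρ ^ (p - 1) := by
        have := Real.rpow_le_rpow hR0 h hp0.le
        rwa [hR, ← Real.rpow_mul (by positivity), one_div_mul_cancel hp0.ne', Real.rpow_one] at this
      rw [div_le_iff₀ hb] at h2
      have h3 : ρ ^ p = ρ ^ (p - 1) * ρ := by
        rcases hρ.eq_or_lt with h0 | h0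
        · rw [← h0, Real.zero_rpow (by linarith)]; simp
        · rw [← Real.rpow_add_one h0.ne']; simp
      have h4 := mul_le_mul_of_nonneg_right h2 hρ
      have h5 := mul_nonneg (abs_nonneg c) hR0
      rw [h3]
      linarith

/-- The endpoint `c = b` is allowed when `p = 1`; the Chernoff bound needs it, as the optimal `l`
may equal `b`. Integrability, by contrast, needs a strictly larger exponent to spare. -/
lemma LightTail.exists_bound (htail : LightTail a b p) (ha : IsKernel a) (hb : 0 < b)
    (hp : 1 ≤ p) {c : ℝ} (hc : p = 1 → c ≤ b) :
    ∃ A : ℝ, ∀ x, Real.exp (c * ‖x‖) * a x ≤ A := by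
  obtain ⟨C, hC⟩ := htail
  obtain ⟨K, hK⟩ := exists_linear_le_rpow hb hp hc
  have hC0 : 0 ≤ C := by
    have := (ha.nonneg 0).trans (hC 0)
    exact nonneg_of_mul_nonneg_left this (Real.exp_pos _)
  refine ⟨C * Real.exp K, fun x => ?_⟩
  calc Real.exp (c * ‖x‖) * a x
      ≤ Real.exp (c * ‖x‖) * (C * Real.exp (-b * ‖x‖ ^ p)) :=
        mul_le_mul_of_nonneg_left (hC x) (Real.exp_pos _).le
    _ = C * Real.exp (c * ‖x‖ - b * ‖x‖ ^ p) := by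
        rw [sub_eq_add_neg, Real.exp_add, neg_mul]; ring
    _ ≤ C * Real.exp K := by
        refine mul_le_mul_of_nonneg_left (Real.exp_le_exp.2 ?_) hC0
        linarith [hK ‖x‖ (norm_nonneg x)]

lemma LightTail.integrable_exp_norm (htail : LightTail a b p) (ha : IsKernel a) (hb : 0 < b)
    (hp : 1 ≤ p) {c : ℝ} (hc : p = 1 → c < b) :
    Integrable (fun x => Real.exp (c * ‖x‖) * a x) volume := by
  obtain ⟨c', hcc, hc'⟩ : ∃ c', c < c' ∧ (p = 1 → c' ≤ b) := by
    by_cases h : p = 1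
    · exact ⟨b, hc h, fun _ => le_rfl⟩
    · exact ⟨c + 1, by linarith, fun h' => absurd h' h⟩
  obtain ⟨A, hA⟩ := htail.exists_bound ha hb hp hc'
  refine ((integrable_exp_neg_mul_norm (sub_pos.2 hcc)).const_mul A).mono'
    (ha.aestronglyMeasurable_mul (by fun_prop)) (Eventually.of_forall fun x => ?_)
  rw [Real.norm_of_nonneg (mul_nonneg (Real.exp_pos _).le (ha.nonneg x))]
  calc Real.exp (c * ‖x‖) * a x
      = (Real.exp (c' * ‖x‖) * a x) * Real.exp (-(c' - c) * ‖x‖) := by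
        rw [mul_right_comm, ← Real.exp_add]; congr 2; ring
    _ ≤ A * Real.exp (-(c' - c) * ‖x‖) :=
        mul_le_mul_of_nonneg_right (hA x) (Real.exp_pos _).le

lemma exp_inner_le (γ x : EuclideanSpace ℝ (Fin d)) :
    Real.exp (inner ℝ γ x) ≤ Real.exp (‖γ‖ * ‖x‖) :=
  Real.exp_le_exp.2 (real_inner_le_norm γ x)

lemma LightTail.mem_effDomain (htail : LightTail a b p) (ha : IsKernel a) (hb : 0 < b)
    (hp : 1 ≤ p) {γ : EuclideanSpace ℝ (Fin d)} (hγ : p = 1 → ‖γ‖ < b) : γ ∈ effDomain a := by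
  rw [ha.mem_effDomain_iff]
  refine (htail.integrable_exp_norm ha hb hp hγ).mono' (ha.aestronglyMeasurable_exp γ)
    (Eventually.of_forall fun x => ?_)
  rw [Real.norm_of_nonneg (mul_nonneg (Real.exp_pos _).le (ha.nonneg x))]
  exact mul_le_mul_of_nonneg_right (exp_inner_le γ x) (ha.nonneg x)

lemma CondA1.norm_le (hA1 : CondA1 a b) (hb : 0 < b) {γ : EuclideanSpace ℝ (Fin d)}
    (hγ : γ ∈ effDomain a) : ‖γ‖ ≤ b := by
  by_contra! h
  have hn : 0 < ‖γ‖ := hb.trans h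
  refine hγ ?_
  have := hA1 ‖γ‖ h (‖γ‖⁻¹ • γ) (by rw [norm_smul, norm_inv, norm_norm, inv_mul_cancel₀ hn.ne'])
  rwa [smul_smul, mul_inv_cancel₀ hn.ne', one_smul] at this

lemma IsKernel.convPow_nonneg (ha : IsKernel a) (k : ℕ) (x : EuclideanSpace ℝ (Fin d)) :
    0 ≤ convPow a k x := by
  induction k generalizing x with
  | zero => exact ha.nonneg x
  | succ k ih => exact integral_nonneg fun t => mul_nonneg (ih t) (ha.nonneg _)

lemma IsKernel.integrable_convPow (ha : IsKernel a) (k : ℕ) : Integrable (convPow a k) volume := by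
  induction k with
  | zero => exact ha.integrable
  | succ k ih => exact ih.integrable_convolution _ ha.integrable

lemma IsKernel.convolutionExists (ha : IsKernel a) {A : ℝ} (hA : ∀ x, a x ≤ A) (k : ℕ) :
    ConvolutionExists (convPow a k) a (ContinuousLinearMap.lsmul ℝ ℝ) volume := fun x => by
  refine (ha.integrable_convPow k).mul_bdd (c := A)
    (ha.integrable.comp_sub_left x).aestronglyMeasurable (Eventually.of_forall fun t => ?_)
  rw [Real.norm_of_nonneg (ha.nonneg _)]
  exact hA _

/-- Exponential tilting bounds the convolution powers pointwise. -/
lemma IsKernel.convPow_le (ha : IsKernel a) {C A : ℝ} (hC : ∀ x, a x ≤ C)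
    {γ : EuclideanSpace ℝ (Fin d)}
    (hγ : γ ∈ effDomain a) (hA : ∀ x, Real.exp (inner ℝ γ x) * a x ≤ A) (k : ℕ)
    (x : EuclideanSpace ℝ (Fin d)) :
    convPow a k x ≤ A * momentReal a γ ^ k * Real.exp (-inner ℝ γ x) := by
  have hi := ha.mem_effDomain_iff.1 hγ
  induction k generalizing x with
  | zero =>
    rw [pow_zero, mul_one, Real.exp_neg, ← div_eq_mul_inv, le_div_iff₀ (Real.exp_pos _), mul_comm]
    exact hA x
  | succ k ih =>
    have hsplit : ∀ t, Real.exp (-inner ℝ γ t) * a (x - t) =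
        Real.exp (-inner ℝ γ x) * (Real.exp (inner ℝ γ (x - t)) * a (x - t)) := fun t => by
      rw [← mul_assoc, ← Real.exp_add, inner_sub_right]
      congr 2; ring
    have hint : Integrable (fun t => A * momentReal a γ ^ k * Real.exp (-inner ℝ γ t) * a (x - t))
        volume := by
      simp only [mul_assoc (A * momentReal a γ ^ k), hsplit]
      exact ((hi.comp_sub_left x).const_mul _).const_mul _
    calc convPow a (k + 1) x = ∫ t, convPow a k t * a (x - t) := rfl
      _ ≤ ∫ t, A * momentReal a γ ^ k * Real.exp (-inner ℝ γ t) * a (x - t) :=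
        integral_mono (ha.convolutionExists hC k x) hint fun t =>
          mul_le_mul_of_nonneg_right (ih t) (ha.nonneg _)
      _ = A * momentReal a γ ^ (k + 1) * Real.exp (-inner ℝ γ x) := by
        simp only [mul_assoc (A * momentReal a γ ^ k), hsplit]
        rw [integral_const_mul, integral_const_mul,
          integral_sub_left_eq_self (fun t => Real.exp (inner ℝ γ t) * a t) volume x,
          ← ha.momentReal_eq, pow_succ]
        ring

lemma hasSum_pow_succ_div_factorial (y : ℝ) :
    HasSum (fun k : ℕ => y ^ (k + 1) / ((k + 1).factorial : ℝ)) (Real.exp y - 1) := by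
  have h : HasSum (fun k : ℕ => y ^ k / (k.factorial : ℝ)) (Real.exp y) := by
    rw [Real.exp_eq_exp_ℝ]
    exact NormedSpace.expSeries_div_hasSum_exp y
  simpa using (hasSum_nat_add_iff' 1).2 h

lemma IsKernel.summable_heatTerm (ha : IsKernel a) {C : ℝ} (hC : ∀ x, a x ≤ C)
    (x : EuclideanSpace ℝ (Fin d)) (t : ℝ) : Summable (heatTerm a x t) := by
  refine Summable.of_norm_bounded (g := fun k : ℕ => C * (|t| ^ (k + 1) / ((k + 1).factorial : ℝ)))
    ((hasSum_pow_succ_div_factorial |t|).summable.mul_left C) fun k => ?_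
  have h1 := ha.convPow_le hC ha.zero_mem_effDomain (A := C) (by simpa using hC) k x
  rw [ha.momentReal_zero] at h1
  simp only [one_pow, mul_one, inner_zero_left, neg_zero, Real.exp_zero] at h1
  rw [heatTerm, norm_div, norm_mul, norm_pow, Real.norm_eq_abs,
    Real.norm_of_nonneg (ha.convPow_nonneg k x),
    Real.norm_of_nonneg (by positivity : (0 : ℝ) ≤ ((k + 1).factorial : ℝ)), mul_div_right_comm,
    mul_comm C]
  exact mul_le_mul_of_nonneg_left h1 (by positivity)

lemma IsKernel.heatKernel_le (ha : IsKernel a) {C A : ℝ} (hC : ∀ x, a x ≤ C)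
    {γ : EuclideanSpace ℝ (Fin d)} (hγ : γ ∈ effDomain a) (h1 : 1 ≤ momentReal a γ)
    (hA : ∀ x, Real.exp (inner ℝ γ x) * a x ≤ A) (x : EuclideanSpace ℝ (Fin d)) {t : ℝ}
    (ht : 0 ≤ t) :
    heatKernel a x t ≤ A * Real.exp (t * (momentReal a γ - 1) - inner ℝ γ x) := by
  have hA0 : 0 ≤ A := (mul_nonneg (Real.exp_pos _).le (ha.nonneg 0)).trans (hA 0)
  set M := momentReal a γ
  have hs := (hasSum_pow_succ_div_factorial (t * M)).mul_left (A * Real.exp (-inner ℝ γ x))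
  have h2 : ∑' k, heatTerm a x t k ≤ A * Real.exp (-inner ℝ γ x) * (Real.exp (t * M) - 1) := by
    refine ((ha.summable_heatTerm hC x t).tsum_le_tsum (fun k => ?_) hs.summable).trans
      hs.tsum_eq.le
    -- `convPow a k` is the `(k+1)`-fold power but its bound carries only `M ^ k`; `1 ≤ M` supplies
    -- the missing factor, so that the series sums to an exponential.
    have h3 : convPow a k x ≤ A * Real.exp (-inner ℝ γ x) * M ^ (k + 1) := by
      refine (ha.convPow_le hC hγ hA k x).trans ?_
      rw [mul_right_comm]
      exact mul_le_mul_of_nonneg_left (pow_le_pow_right₀ h1 (Nat.le_succ k))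
        (mul_nonneg hA0 (Real.exp_pos _).le)
    rw [heatTerm, mul_pow, mul_div_assoc', mul_left_comm]
    have h4 := mul_le_mul_of_nonneg_left h3 (pow_nonneg ht (k + 1))
    gcongr
  rw [heatKernel]
  calc Real.exp (-t) * ∑' k, heatTerm a x t k
      ≤ Real.exp (-t) * (A * Real.exp (-inner ℝ γ x) * (Real.exp (t * M) - 1)) :=
        mul_le_mul_of_nonneg_left h2 (Real.exp_pos _).le
    _ ≤ Real.exp (-t) * (A * Real.exp (-inner ℝ γ x) * Real.exp (t * M)) := by
        have := mul_nonneg hA0 (Real.exp_pos (-inner ℝ γ x)).le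
        gcongr
        linarith
    _ = A * Real.exp (t * (M - 1) - inner ℝ γ x) := by
        rw [show t * (M - 1) - inner ℝ γ x = -t + (-inner ℝ γ x + t * M) by ring, Real.exp_add,
          Real.exp_add]
        ring

end NonlocalHeat

/-! ### Asymptotics of one-variable Legendre transforms. -/

namespace NonlocalHeat

/-- `φ(s)` is the attained supremum of `l s - M(l) + 1` over `l ∈ D ∩ [0, ∞)`, for `s > 0`. -/
def IsScalarLegendre (D : Set ℝ) (M φ : ℝ → ℝ) : Prop :=
  ∀ s : ℝ, 0 < s → IsGreatest {y | ∃ l : ℝ, 0 ≤ l ∧ l ∈ D ∧ y = l * s - M l + 1} (φ s)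

variable {D : Set ℝ} {M φ : ℝ → ℝ}

lemma IsScalarLegendre.le (h : IsScalarLegendre D M φ) {s l : ℝ} (hs : 0 < s) (hl : 0 ≤ l)
    (hlD : l ∈ D) : l * s - M l + 1 ≤ φ s :=
  (h s hs).2 ⟨l, hl, hlD, rfl⟩

lemma IsScalarLegendre.tendsto_atTop (h : IsScalarLegendre D M φ) {l : ℝ} (hl : 0 < l)
    (hlD : l ∈ D) : Tendsto φ atTop atTop := by
  refine tendsto_atTop_mono' atTop ?_ (tendsto_atTop_add_const_right atTop (-M l + 1)
    (tendsto_id.const_mul_atTop hl))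
  filter_upwards [eventually_gt_atTop 0] with s hs
  have := h.le hs hl.le hlD
  simp only [id]
  linarith

lemma isEquivalent_of_forall_eventually {α : Type*} {F : Filter α} {u v : α → ℝ}
    (hv : ∀ᶠ x in F, 0 ≤ v x)
    (h : ∀ c : ℝ, 0 < c → c < 1 →
      ∀ᶠ x in F, (1 - c) * v x ≤ u x ∧ u x ≤ (1 + c) * v x) : u ~[F] v := by
  rw [IsEquivalent, isLittleO_iff]
  intro c hc
  have hc' : 0 < min c (1 / 2) := lt_min hc (by norm_num)
  filter_upwards [hv, h _ hc' ((min_le_right _ _).trans_lt (by norm_num))] with x hx hx2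
  have h3 := mul_le_mul_of_nonneg_right (min_le_left c (1 / 2)) hx
  rw [Pi.sub_apply, Real.norm_eq_abs, Real.norm_of_nonneg hx, abs_le]
  constructor <;> linarith [hx2.1, hx2.2]

/-- The trial value `l = s / σ` maximizes the quadratic model, its cubic error being `O(s³)`. The
upper bound is completion of the square. -/
lemma IsScalarLegendre.isEquivalent_sq (h : IsScalarLegendre D M φ) {σ δ K : ℝ} (hσ : 0 < σ)
    (hδ : 0 < δ) (hlow : ∀ l ∈ D, 1 + σ / 2 * l ^ 2 ≤ M l)
    (hup : ∀ l, 0 ≤ l → l ≤ δ → l ∈ D ∧ M l ≤ 1 + σ / 2 * l ^ 2 + K * l ^ 3) :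
    φ ~[𝓝[>] 0] fun s => s ^ 2 / (2 * σ) := by
  refine isEquivalent_of_forall_eventually (Eventually.of_forall fun s => by positivity)
    fun c hc _ => ?_
  have h1 : ∀ᶠ s : ℝ in 𝓝[>] 0, s / σ ≤ δ := by
    have : Tendsto (fun s : ℝ => s / σ) (𝓝[>] 0) (𝓝 0) := by
      have : Continuous fun s : ℝ => s / σ := by fun_prop
      simpa using (this.tendsto 0).mono_left nhdsWithin_le_nhds
    exact (this.eventually (gt_mem_nhds hδ)).mono fun _ => le_of_lt
  have h2 : ∀ᶠ s : ℝ in 𝓝[>] 0, K * (s / σ ^ 2) ≤ c / 2 := by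
    have : Tendsto (fun s : ℝ => K * (s / σ ^ 2)) (𝓝[>] 0) (𝓝 0) := by
      have : Continuous fun s : ℝ => K * (s / σ ^ 2) := by fun_prop
      simpa using (this.tendsto 0).mono_left nhdsWithin_le_nhds
    exact (this.eventually (gt_mem_nhds (half_pos hc))).mono fun _ => le_of_lt
  filter_upwards [self_mem_nhdsWithin, h1, h2] with s hs hs1 hs2
  have hs0 : 0 < s := hs
  constructor
  · obtain ⟨h3, h4⟩ := hup (s / σ) (by positivity) hs1
    have h5 := h.le hs0 (by positivity) h3
    have h6 : K * (s / σ) ^ 3 ≤ c * (s ^ 2 / (2 * σ)) := by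
      have := mul_le_mul_of_nonneg_right hs2 (by positivity : 0 ≤ s ^ 2 / σ)
      calc K * (s / σ) ^ 3 = K * (s / σ ^ 2) * (s ^ 2 / σ) := by field_simp
        _ ≤ c / 2 * (s ^ 2 / σ) := this
        _ = _ := by field_simp
    have h7 : s / σ * s - σ / 2 * (s / σ) ^ 2 = s ^ 2 / (2 * σ) := by field_simp; ring
    linarith
  · obtain ⟨l, -, hlD, hl⟩ := (h s hs0).1
    have h3 := hlow l hlD
    have h4 : s ^ 2 / (2 * σ) - (l * s - σ / 2 * l ^ 2) = (s - σ * l) ^ 2 / (2 * σ) := by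
      field_simp; ring
    have h5 : 0 ≤ (s - σ * l) ^ 2 / (2 * σ) := by positivity
    have h6 : 0 ≤ c * (s ^ 2 / (2 * σ)) := by positivity
    rw [hl]
    linarith

lemma IsScalarLegendre.isEquivalent_linear (h : IsScalarLegendre D M φ) {b : ℝ} (hb : 0 < b)
    (hM : ∀ l ∈ D, 1 ≤ M l) (hD : ∀ l ∈ D, l ≤ b) (hD' : ∀ l, 0 ≤ l → l < b → l ∈ D) :
    φ ~[atTop] fun s => b * s := by
  refine isEquivalent_of_forall_eventually
    ((eventually_ge_atTop 0).mono fun s hs => mul_nonneg hb.le hs) fun c hc hc1 => ?_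
  -- Half of the allowed loss `c` keeps `l` inside the domain; the other half absorbs the constant
  -- `M l` for large `s`.
  set l := (1 - c / 2) * b with hl
  have hl0 : 0 ≤ l := mul_nonneg (by linarith) hb.le
  have hlD : l ∈ D := hD' l hl0 (by nlinarith)
  filter_upwards [eventually_gt_atTop 0,
    (tendsto_id.const_mul_atTop (by positivity : 0 < c / 2 * b)).eventually_ge_atTop (M l)]
    with s hs hs1
  simp only [id] at hs1
  constructor
  · have h1 := h.le hs hl0 hlD
    rw [hl] at h1 hs1
    linarith
  · obtain ⟨l', hl', hlD', hle⟩ := (h s hs).1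
    have h1 := mul_le_mul_of_nonneg_right (hD l' hlD') hs.le
    have h2 := hM l' hlD'
    have h3 : 0 ≤ c * (b * s) := by positivity
    rw [hle]
    linarith

lemma IsScalarLegendre.eventually_mul_log_le (h : IsScalarLegendre D M φ) {μ : ℝ} (hμ : 0 < μ)
    (hM : ∀ η : ℝ, 0 < η → ∀ᶠ l in atTop, l ∈ D ∧ M l ≤ η * Real.exp (μ * l)) :
    ∀ᶠ s : ℝ in atTop, 1 / μ * (s * Real.log s) ≤ φ s := by
  -- This `l` maximizes `l s - η e^{μ l}` for `η = 1/(μ e)`. The gain `s / μ` then exactly pays for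
  -- the bound on `M l`.
  have ht : Tendsto (fun s : ℝ => (Real.log s + 1) / μ) atTop atTop :=
    (tendsto_atTop_add_const_right _ _ Real.tendsto_log_atTop).atTop_div_const hμ
  filter_upwards [eventually_gt_atTop 0, ht.eventually_ge_atTop 0,
    ht.eventually (hM (1 / (μ * Real.exp 1)) (by positivity))] with s hs hl hMl
  have h1 := h.le hs hl hMl.1
  have h2 := hMl.2
  rw [mul_div_cancel₀ _ hμ.ne', Real.exp_add, Real.exp_log hs] at h2
  have h3 : 1 / (μ * Real.exp 1) * (s * Real.exp 1) = s / μ := by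
    have := (Real.exp_pos 1).ne'
    field_simp
  have h4 : (Real.log s + 1) / μ * s = 1 / μ * (s * Real.log s) + s / μ := by field_simp
  linarith

/-- At `w = (ln s / K)^{1/q}` the model `e^{K w^q}` equals `s`. Slightly below `w`, `M` is at most
`s`, negligible against `w s`; slightly above, `M(l)` already exceeds `l s`, so larger `l`
contribute at most `1`. -/
lemma IsScalarLegendre.isEquivalent_log_rpow (h : IsScalarLegendre D M φ) {K q : ℝ} (hK : 0 < K)
    (hq : 0 < q) (hM : ∀ l ∈ D, 1 ≤ M l) (hD : ∀ l, 0 ≤ l → l ∈ D)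
    (hlog : (fun l => Real.log (M l)) ~[atTop] fun l => K * l ^ q) :
    φ ~[atTop] fun s => s * (Real.log s / K) ^ (1 / q) := by
  have hpos : ∀ᶠ l : ℝ in atTop, 0 < K * l ^ q :=
    (eventually_gt_atTop 0).mono fun l hl => by positivity
  have hratio : Tendsto (fun l => Real.log (M l) / (K * l ^ q)) atTop (𝓝 1) :=
    (isEquivalent_iff_tendsto_one (hpos.mono fun l hl => hl.ne')).1 hlog
  have hw : Tendsto (fun s : ℝ => (Real.log s / K) ^ (1 / q)) atTop atTop :=
    (tendsto_rpow_atTop (by positivity)).comp (Real.tendsto_log_atTop.atTop_div_const hK)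
  have hwq : ∀ c : ℝ, 0 ≤ c → ∀ᶠ s : ℝ in atTop,
      K * (c * (Real.log s / K) ^ (1 / q)) ^ q = c ^ q * Real.log s := fun c hc => by
    filter_upwards [Real.tendsto_log_atTop.eventually_gt_atTop 0] with s hs
    rw [Real.mul_rpow hc (by positivity), ← Real.rpow_mul (by positivity),
      one_div_mul_cancel hq.ne', Real.rpow_one]
    field_simp
  refine isEquivalent_of_forall_eventually ?_ fun c hc hc1 => ?_
  · filter_upwards [eventually_gt_atTop 0, hw.eventually_ge_atTop 0] with s hs hs1
    exact mul_nonneg hs.le hs1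
  have hup : ∀ᶠ s : ℝ in atTop, φ s ≤ (1 + c) * (s * (Real.log s / K) ^ (1 / q)) := by
    -- For `l > (1 + c) w` one has `ln s ≤ κ K l^q` with `κ < 1`. Of the gap, one half absorbs `ln
    -- l` and the other the error in `ln M ~ K l^q`.
    set κ := ((1 + c) ^ q)⁻¹ with hκ
    have hκ1 : κ < 1 := inv_lt_one_of_one_lt₀ (Real.one_lt_rpow (by linarith) hq)
    have hκ0 : 0 < κ := by positivity
    have hE1 : ∀ᶠ l : ℝ in atTop, (1 + κ) / 2 * (K * l ^ q) ≤ Real.log (M l) := by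
      filter_upwards [hratio.eventually (lt_mem_nhds (show (1 + κ) / 2 < 1 by linarith)), hpos]
        with l hl hl2
      exact ((lt_div_iff₀ hl2).1 hl).le
    have hE2 : ∀ᶠ l : ℝ in atTop, Real.log l ≤ (1 - κ) / 2 * (K * l ^ q) := by
      have hc0 : 0 < (1 - κ) / 2 * K := mul_pos (by linarith) hK
      filter_upwards [(isLittleO_log_rpow_atTop hq).bound hc0, eventually_gt_atTop 0] with l hl hl0
      rw [Real.norm_of_nonneg (by positivity : 0 ≤ l ^ q)] at hl
      exact (le_abs_self _).trans (hl.trans_eq (by ring))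
    obtain ⟨l₀, hl₀⟩ := eventually_atTop.1 (hE1.and (hE2.and (eventually_gt_atTop 0)))
    have hwc : Tendsto (fun s : ℝ => (1 + c) * (Real.log s / K) ^ (1 / q)) atTop atTop :=
      hw.const_mul_atTop (by linarith)
    filter_upwards [eventually_ge_atTop 1, hwc.eventually_ge_atTop (max l₀ 1),
      hwq (1 + c) (by linarith)] with s hs hs1 hs2
    have hs0 : 0 < s := by linarith
    set w := (1 + c) * (Real.log s / K) ^ (1 / q) with hwdef
    have hgoal : (1 + c) * (s * (Real.log s / K) ^ (1 / q)) = w * s := by rw [hwdef]; ring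
    have hw1 : 1 ≤ w := (le_max_right _ _).trans hs1
    rw [hgoal]
    obtain ⟨l, hl, hlD, hle⟩ := (h s hs0).1
    have hM1 := hM l hlD
    rw [hle]
    rcases le_or_gt l w with hlw | hlw
    · have := mul_le_mul_of_nonneg_right hlw hs0.le
      linarith
    · obtain ⟨h1, h2, h3⟩ := hl₀ l (((le_max_left _ _).trans hs1).trans hlw.le)
      have h4 : Real.log s ≤ κ * (K * l ^ q) := by
        have h5 : K * w ^ q ≤ K * l ^ q :=
          mul_le_mul_of_nonneg_left (Real.rpow_le_rpow (by linarith) hlw.le hq.le) hK.le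
        rw [hs2] at h5
        rw [hκ, inv_mul_eq_div, le_div_iff₀ (by positivity)]
        linarith
      have h6 : Real.log (l * s) ≤ Real.log (M l) := by
        rw [Real.log_mul h3.ne' hs0.ne']
        linarith
      have h7 := (Real.log_le_log_iff (by positivity) (by linarith)).1 h6
      nlinarith
  have hlow : ∀ᶠ s : ℝ in atTop, (1 - c) * (s * (Real.log s / K) ^ (1 / q)) ≤ φ s := by
    -- With this `κ > 1` the bound on `ln M` at `(1 - c/2) w` is exactly `ln s`. The resulting loss
    -- `s` fits in `(c/2) w s` once `w ≥ 2 / c`.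
    set κ := ((1 - c / 2) ^ q)⁻¹ with hκ
    have hc2 : 0 < 1 - c / 2 := by linarith
    have hκ1 : 1 < κ := (one_lt_inv₀ (by positivity)).2 (Real.rpow_lt_one hc2.le (by linarith) hq)
    have hE1 : ∀ᶠ l : ℝ in atTop, Real.log (M l) ≤ κ * (K * l ^ q) := by
      filter_upwards [hratio.eventually (gt_mem_nhds hκ1), hpos] with l hl hl2
      exact ((div_lt_iff₀ hl2).1 hl).le
    have hwc : Tendsto (fun s : ℝ => (1 - c / 2) * (Real.log s / K) ^ (1 / q)) atTop atTop :=
      hw.const_mul_atTop hc2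
    filter_upwards [eventually_gt_atTop 0, hwc.eventually hE1, hwc.eventually_ge_atTop 0,
      hwq (1 - c / 2) hc2.le, hw.eventually_ge_atTop (2 / c)] with s hs hs1 hs2 hs3 hs4
    have h1 := h.le hs hs2 (hD _ hs2)
    have hMpos := hM _ (hD _ hs2)
    rw [hs3, hκ, inv_mul_cancel_left₀ (by positivity)] at hs1
    have h2 := (Real.log_le_log_iff (by linarith) hs).1 hs1
    rw [div_le_iff₀ hc] at hs4
    have h3 := mul_le_mul_of_nonneg_right hs4 hs.le
    nlinarith
  exact hlow.and hup

lemma rpow_constant_eq {b p L : ℝ} (hb : 0 < b) (hp : 1 < p) (hL : 0 ≤ L) :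
    (L / ((p - 1) / p * (b * p) ^ (-(1 / (p - 1))))) ^ (1 / (p / (p - 1))) =
      p / (p - 1) * (b * (p - 1)) ^ (1 / p) * L ^ ((p - 1) / p) := by
  have h1 : 0 < p - 1 := by linarith
  have h0 : 0 < p := by linarith
  have hK : 0 < (p - 1) / p * (b * p) ^ (-(1 / (p - 1))) := by positivity
  rw [Real.div_rpow hL hK.le, one_div_div, div_eq_mul_inv, mul_comm]
  congr 1
  refine Real.log_injOn_pos (Set.mem_Ioi.2 (by positivity)) (Set.mem_Ioi.2 (by positivity)) ?_
  rw [Real.log_inv, Real.log_rpow hK, Real.log_mul (by positivity) (by positivity),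
    Real.log_div h1.ne' h0.ne', Real.log_rpow (by positivity), Real.log_mul hb.ne' h0.ne',
    Real.log_mul (by positivity) (by positivity), Real.log_div h0.ne' h1.ne',
    Real.log_rpow (by positivity), Real.log_mul hb.ne' h1.ne']
  field_simp
  ring

end NonlocalHeat

/-! ### One-variable estimates for the kernel and the bound along `|x| ~ s t`. -/

namespace NonlocalHeat

/-- For small `l` the gain `l s` is linear while `M l - 1` is bounded by a quadratic plus a cubic
term. Positivity permits division by `φ(s)` when an error is written as a factor `1 + ε`. -/
lemma IsScalarLegendre.pos {D : Set ℝ} {M φ : ℝ → ℝ} (h : IsScalarLegendre D M φ) {σ δ K : ℝ}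
    (hδ : 0 < δ)
    (hup : ∀ l, 0 ≤ l → l ≤ δ → l ∈ D ∧ M l ≤ 1 + σ / 2 * l ^ 2 + K * l ^ 3) {s : ℝ}
    (hs : 0 < s) : 0 < φ s := by
  have ht : Tendsto (fun l : ℝ => σ / 2 * l + K * l ^ 2) (𝓝[>] 0) (𝓝 0) := by
    have : Continuous fun l : ℝ => σ / 2 * l + K * l ^ 2 := by fun_prop
    simpa using (this.tendsto 0).mono_left nhdsWithin_le_nhds
  obtain ⟨l, hl, hl0, hlδ⟩ := ((ht.eventually (gt_mem_nhds hs)).and (Ioo_mem_nhdsGT hδ)).exists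
  obtain ⟨hD, hM⟩ := hup l hl0.le hlδ.le
  have h1 := h.le hs hl0.le hD
  have h2 := mul_lt_mul_of_pos_left hl hl0
  nlinarith

lemma exp_le_cubic (u : ℝ) :
    Real.exp u ≤ 1 + u + u ^ 2 / 2 + |u| ^ 3 * Real.exp |u| := by
  have h := Complex.norm_exp_sub_sum_le_norm_mul_exp (u : ℂ) 3
  have h1 : Complex.exp u - ∑ m ∈ Finset.range 3, (u : ℂ) ^ m / (m.factorial : ℂ) =
      ((Real.exp u - (1 + u + u ^ 2 / 2) : ℝ) : ℂ) := by
    simp [Finset.sum_range_succ, Nat.factorial]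
  rw [h1, Complex.norm_real, Complex.norm_real, Real.norm_eq_abs, Real.norm_eq_abs] at h
  linarith [(abs_le.1 h).2]

variable {d : ℕ} {a : EuclideanSpace ℝ (Fin d) → ℝ} {b p : ℝ}

lemma IsKernel.integrable_inner (ha : IsKernel a) (v : EuclideanSpace ℝ (Fin d)) :
    Integrable (fun x => (inner ℝ v x : ℝ) * a x) volume := by
  refine (ha.integrable.add (ha.integrable_inner_sq v)).mono'
    (ha.aestronglyMeasurable_mul (by fun_prop)) (Eventually.of_forall fun x => ?_)
  rw [norm_mul, Real.norm_of_nonneg (ha.nonneg x), Real.norm_eq_abs, Pi.add_apply]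
  have h1 : |(inner ℝ v x : ℝ)| ≤ 1 + (inner ℝ v x : ℝ) ^ 2 := by
    rw [← sq_abs]
    nlinarith [sq_nonneg (|(inner ℝ v x : ℝ)| - 1), abs_nonneg (inner ℝ v x : ℝ)]
  have := mul_le_mul_of_nonneg_right h1 (ha.nonneg x)
  linarith

lemma IsRadial.integral_inner_eq_zero (hrad : IsRadial a) (v : EuclideanSpace ℝ (Fin d)) :
    ∫ x, (inner ℝ v x : ℝ) * a x = 0 := by
  have h := hrad.integral_inner_eq (fun u => u) (norm_neg v)
  simp only [inner_neg_left, neg_mul, integral_neg] at h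
  linarith

lemma LightTail.integrable_cube_exp (htail : LightTail a b p) (ha : IsKernel a) (hb : 0 < b)
    (hp : 1 ≤ p) :
    Integrable (fun x => ‖x‖ ^ 3 * Real.exp (b / 2 * ‖x‖) * a x) volume := by
  refine ((htail.integrable_exp_norm ha hb hp (c := 3 / 4 * b) fun _ => by linarith).const_mul
    (6 / (b / 4) ^ 3)).mono' (ha.aestronglyMeasurable_mul (by fun_prop))
    (Eventually.of_forall fun x => ?_)
  have hx := ha.nonneg x
  rw [Real.norm_of_nonneg (by positivity), ← mul_assoc]
  refine mul_le_mul_of_nonneg_right ?_ hx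
  have h := Real.pow_div_factorial_le_exp (b / 4 * ‖x‖) (by positivity) 3
  have h6 : ((3 : ℕ).factorial : ℝ) = 6 := by norm_num [Nat.factorial]
  rw [h6, mul_pow, div_le_iff₀ (by norm_num)] at h
  rw [show 3 / 4 * b * ‖x‖ = b / 4 * ‖x‖ + b / 2 * ‖x‖ by ring, Real.exp_add, ← mul_assoc]
  refine mul_le_mul_of_nonneg_right ?_ (Real.exp_pos _).le
  rw [div_mul_eq_mul_div, le_div_iff₀ (by positivity)]
  linarith

/-- Third-order Taylor bound under the integral; the linear term vanishes by symmetry, and `l ≤ b /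
2` keeps the remainder integrable. -/
lemma LightTail.momentReal_le_cubic (htail : LightTail a b p) (ha : IsKernel a)
    (hrad : IsRadial a) (hb : 0 < b) (hp : 1 ≤ p) {e : EuclideanSpace ℝ (Fin d)} (he : ‖e‖ = 1)
    {l : ℝ} (hl : 0 ≤ l) (hlb : l ≤ b / 2) :
    l • e ∈ effDomain a ∧ momentReal a (l • e) ≤ 1 + dirVariance a e / 2 * l ^ 2 +
      (∫ x, ‖x‖ ^ 3 * Real.exp (b / 2 * ‖x‖) * a x) * l ^ 3 := by
  have hn : ‖l • e‖ = l := by rw [norm_smul, he, mul_one, Real.norm_of_nonneg hl]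
  have hmem : l • e ∈ effDomain a := htail.mem_effDomain ha hb hp fun _ => by rw [hn]; linarith
  refine ⟨hmem, ?_⟩
  have h1 := ha.integrable
  have h2 := (ha.integrable_inner e).const_mul l
  have h3 := (ha.integrable_inner_sq e).const_mul (l ^ 2 / 2)
  have h4 := (htail.integrable_cube_exp ha hb hp).const_mul (l ^ 3)
  have h12 : Integrable (fun x => a x + l * (inner ℝ e x * a x)) volume := h1.add h2
  have h123 : Integrable (fun x => a x + l * (inner ℝ e x * a x) +
      l ^ 2 / 2 * ((inner ℝ e x : ℝ) ^ 2 * a x)) volume := h12.add h3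
  have hle : momentReal a (l • e) ≤ ∫ x, (a x + l * (inner ℝ e x * a x) +
      l ^ 2 / 2 * ((inner ℝ e x : ℝ) ^ 2 * a x) +
      l ^ 3 * (‖x‖ ^ 3 * Real.exp (b / 2 * ‖x‖) * a x)) := by
    rw [ha.momentReal_eq]
    refine integral_mono (ha.mem_effDomain_iff.1 hmem) (h123.add h4) fun x => ?_
    have hu : |l * (inner ℝ e x : ℝ)| ≤ l * ‖x‖ := by
      rw [abs_mul, abs_of_nonneg hl]
      refine mul_le_mul_of_nonneg_left ?_ hl
      simpa [he] using abs_real_inner_le_norm e x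
    have h5 := exp_le_cubic (l * (inner ℝ e x : ℝ))
    have h6 : |l * (inner ℝ e x : ℝ)| ^ 3 * Real.exp |l * (inner ℝ e x : ℝ)| ≤
        (l * ‖x‖) ^ 3 * Real.exp (b / 2 * ‖x‖) := by
      refine mul_le_mul (pow_le_pow_left₀ (abs_nonneg _) hu 3) (Real.exp_le_exp.2 (hu.trans ?_))
        (Real.exp_pos _).le (by positivity)
      exact mul_le_mul_of_nonneg_right hlb (norm_nonneg x)
    have h7 := mul_le_mul_of_nonneg_right (h5.trans (add_le_add_right h6 _)) (ha.nonneg x)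
    simp only [real_inner_smul_left]
    refine h7.trans_eq ?_
    ring
  rw [integral_add h123 h4, integral_add h12 h3, integral_add h1 h2,
    integral_const_mul, integral_const_mul, integral_const_mul, ha.integral_eq_one,
    hrad.integral_inner_eq_zero, ← dirVariance] at hle
  linarith

/-- For a kernel supported in the ball of radius `μ`, the moment is `o(e^{μ l})`. -/
lemma SupportedInBall.eventually_momentReal_le {μ : ℝ} (hsupp : SupportedInBall a μ)
    (ha : IsKernel a) {e : EuclideanSpace ℝ (Fin d)} (he : ‖e‖ = 1) {η : ℝ} (hη : 0 < η) :
    ∀ᶠ l : ℝ in atTop, l • e ∈ effDomain a ∧ momentReal a (l • e) ≤ η * Real.exp (μ * l) := by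
  have hzero : ∀ x, a x ≠ 0 → (inner ℝ e x : ℝ) ≤ μ := fun x hx => by
    have h1 : ‖x‖ ≤ μ := by simpa using hsupp.2 (subset_tsupport a hx)
    have h2 := real_inner_le_norm e x
    rw [he, one_mul] at h2
    exact h2.trans h1
  have hbound : ∀ l : ℝ, 0 ≤ l → ∀ x,
      ‖Real.exp (l * ((inner ℝ e x : ℝ) - μ)) * a x‖ ≤ a x := fun l hl x => by
    rw [Real.norm_of_nonneg (mul_nonneg (Real.exp_pos _).le (ha.nonneg x))]
    by_cases hx : a x = 0
    · simp [hx]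
    · refine mul_le_of_le_one_left (ha.nonneg x) (Real.exp_le_one_iff.2 ?_)
      exact mul_nonpos_of_nonneg_of_nonpos hl (sub_nonpos.2 (hzero x hx))
  have hmeas : ∀ l : ℝ, AEStronglyMeasurable
      (fun x => Real.exp (l * ((inner ℝ e x : ℝ) - μ)) * a x) volume := fun l =>
    ha.aestronglyMeasurable_mul (by fun_prop)
  have hlim : Tendsto (fun l : ℝ => ∫ x, Real.exp (l * ((inner ℝ e x : ℝ) - μ)) * a x) atTop
      (𝓝 (∫ _ : EuclideanSpace ℝ (Fin d), (0 : ℝ))) := by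
    refine tendsto_integral_filter_of_dominated_convergence a (Eventually.of_forall hmeas)
      ((eventually_ge_atTop 0).mono fun l hl => Eventually.of_forall (hbound l hl))
      ha.integrable ?_
    have hne : e ≠ 0 := by rintro rfl; simp at he
    -- On the support `e · x ≤ μ`, with equality only on a null hyperplane, so the integrand tends
    -- to `0` almost everywhere while dominated by `a`.
    have hae : ∀ᵐ x ∂(volume : Measure (EuclideanSpace ℝ (Fin d))), ¬ (inner ℝ e x = μ) := by
      simpa [ae_iff] using volume_hyperplane hne μ
    filter_upwards [hae] with x hx
    by_cases hx0 : a x = 0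
    · simp [hx0]
    · have hneg : (inner ℝ e x : ℝ) - μ < 0 := sub_neg.2 (lt_of_le_of_ne (hzero x hx0) hx)
      have := (Real.tendsto_exp_atBot.comp (tendsto_id.atTop_mul_const_of_neg hneg)).mul_const (a x)
      simpa using this
  rw [integral_zero] at hlim
  filter_upwards [hlim.eventually (gt_mem_nhds hη), eventually_ge_atTop 0] with l hl hl0
  have hexp : ∀ x, Real.exp (inner ℝ (l • e) x) * a x =
      Real.exp (μ * l) * (Real.exp (l * ((inner ℝ e x : ℝ) - μ)) * a x) := fun x => by
    rw [← mul_assoc, ← Real.exp_add, real_inner_smul_left]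
    congr 2; ring
  constructor
  · rw [ha.mem_effDomain_iff]
    simp only [hexp]
    exact (ha.integrable.mono' (hmeas l) (Eventually.of_forall (hbound l hl0))).const_mul _
  · rw [ha.momentReal_eq]
    simp only [hexp]
    rw [integral_const_mul, mul_comm]
    exact mul_le_mul_of_nonneg_right hl.le (Real.exp_pos _).le

/-- The upper bound for the heat kernel along `|x| ~ s t`. -/
lemma IsKernel.heatKernel_le_exp (ha : IsKernel a) (hrad : IsRadial a) (hb : 0 < b) (hp : 1 ≤ p)
    (htail : LightTail a b p) {e : EuclideanSpace ℝ (Fin d)} (he : ‖e‖ = 1) {l s c : ℝ}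
    (hl : 0 ≤ l) (hlb : p = 1 → l ≤ b) (hmem : l • e ∈ effDomain a)
    (hc : c = l * s - momentReal a (l • e) + 1) (hc0 : 0 < c) (hs : 0 < s)
    {x : ℝ → EuclideanSpace ℝ (Fin d)}
    (hx : (fun t : ℝ => ‖x t‖) ~[atTop] fun t : ℝ => s * t) :
    ∃ ε : ℝ → ℝ, Tendsto ε atTop (𝓝 0) ∧
      ∀ᶠ t : ℝ in atTop, heatKernel a (x t) t ≤ Real.exp (-(c * t * (1 + ε t))) := by
  obtain ⟨C, hC⟩ := htail.exists_bound ha hb hp (c := 0) fun _ => hb.le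
  obtain ⟨A, hA⟩ := htail.exists_bound ha hb hp hlb
  simp only [zero_mul, Real.exp_zero, one_mul] at hC
  set B := max A 1 with hB
  have hB0 : 0 < B := lt_max_of_lt_right one_pos
  have hratio : Tendsto (fun t => ‖x t‖ / (s * t)) atTop (𝓝 1) :=
    (isEquivalent_iff_tendsto_one ((eventually_gt_atTop 0).mono fun t ht =>
      (mul_pos hs ht).ne')).1 hx
  -- Obtained by solving `ln B + t (Λ - 1) - l ‖x t‖ = -c t (1 + ε)` for `ε`, where `Λ - 1 = l s -
  -- c`.
  refine ⟨fun t => -(Real.log B / c * t⁻¹) - l * s / c * (1 - ‖x t‖ / (s * t)), ?_, ?_⟩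
  · have := ((tendsto_inv_atTop_zero (𝕜 := ℝ)).const_mul (Real.log B / c)).neg.sub
      (((tendsto_const_nhds (x := (1 : ℝ))).sub hratio).const_mul (l * s / c))
    simpa using this
  · filter_upwards [eventually_gt_atTop 0, hratio.eventually (lt_mem_nhds one_pos)] with t ht htx
    have hxt : 0 < ‖x t‖ := by
      by_contra h
      rw [le_antisymm (not_lt.1 h) (norm_nonneg _)] at htx
      simp at htx
    -- The tilt points along `x t` with fixed length `l`; by radial symmetry its moment does not
    -- depend on `t`.
    set γ := (l / ‖x t‖) • x t with hγ
    have hγn : ‖γ‖ = l := by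
      rw [hγ, norm_smul, Real.norm_of_nonneg (by positivity), div_mul_cancel₀ _ hxt.ne']
    have hnorm : ‖l • e‖ = ‖γ‖ := by
      rw [hγn, norm_smul, he, mul_one, Real.norm_of_nonneg hl]
    have hγm : γ ∈ effDomain a := (hrad.mem_effDomain_congr hnorm).1 hmem
    have h1 := ha.heatKernel_le hC hγm (hrad.one_le_momentReal ha he hγm) (A := B) (fun y => by
      refine ((mul_le_mul_of_nonneg_right (exp_inner_le γ y) (ha.nonneg y)).trans ?_).trans
        (le_max_left A 1)
      rw [hγn]
      exact hA y) (x t) ht.le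
    refine h1.trans_eq ?_
    rw [← hrad.momentReal_eq_of_norm_eq hnorm, hγ, real_inner_smul_left,
      real_inner_self_eq_norm_sq, ← Real.exp_log hB0, ← Real.exp_add, Real.exp_log hB0,
      show momentReal a (l • e) = l * s + 1 - c by linarith]
    congr 1
    field_simp
    ring

end NonlocalHeat

/-! ### Assembly along a fixed unit vector. -/

theorem mainTheorem6 (d : ℕ) (hd : 1 ≤ d) (a : EuclideanSpace ℝ (Fin d) → ℝ) (b p : ℝ)
    (hb : 0 < b) (hp : 1 ≤ p)
    (ha : NonlocalHeat.IsKernel a)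
    (htail : NonlocalHeat.LightTail a b p)
    (hA1 : p = 1 → NonlocalHeat.CondA1 a b)
    (hrad : NonlocalHeat.IsRadial a) :
    -- the objects in the claim are well defined
    (∀ k : ℕ, ConvolutionExists (NonlocalHeat.convPow a k) a
      (ContinuousLinearMap.lsmul ℝ ℝ) volume) ∧
    (∀ (x : EuclideanSpace ℝ (Fin d)) (t : ℝ), Summable (NonlocalHeat.heatTerm a x t)) ∧
    (∀ r : EuclideanSpace ℝ (Fin d), r ≠ 0 → ∃! ξ : ℝ, NonlocalHeat.IsXi a r ξ) ∧
    -- the covariance matrix is `σ` times the identity, and `Φ` is a function `φ` of `|r|`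
    ∃ (σ : ℝ) (φ : ℝ → ℝ),
      0 < σ ∧ NonlocalHeat.covMatrix a = σ • (1 : Matrix (Fin d) (Fin d) ℝ) ∧
      (∀ r : EuclideanSpace ℝ (Fin d), NonlocalHeat.Phi a r = φ ‖r‖) ∧
      -- the upper bound for `|x| = s t (1 + o(1))`
      (∀ s : ℝ, 0 < s → ∀ x : ℝ → EuclideanSpace ℝ (Fin d),
        (fun t : ℝ => ‖x t‖) ~[atTop] (fun t : ℝ => s * t) →
        ∃ ε : ℝ → ℝ, Tendsto ε atTop (𝓝 0) ∧
          ∀ᶠ t : ℝ in atTop,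
            NonlocalHeat.heatKernel a (x t) t ≤ Real.exp (-(φ s * t * (1 + ε t)))) ∧
      φ ~[𝓝[>] 0] (fun s : ℝ => s ^ 2 / (2 * σ)) ∧
      Tendsto φ atTop atTop ∧
      (p = 1 → φ ~[atTop] (fun s : ℝ => b * s)) ∧
      (1 < p → NonlocalHeat.CondAp a b p →
        φ ~[atTop] (fun s : ℝ =>
          p / (p - 1) * (b * (p - 1)) ^ (1 / p) * s * Real.log s ^ ((p - 1) / p))) ∧
      (∀ μ : ℝ, 0 < μ → NonlocalHeat.SupportedInBall a μ →
        ∀ᶠ s : ℝ in atTop, 1 / μ * (s * Real.log s) ≤ φ s) := by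
  open NonlocalHeat in
  obtain ⟨e, he⟩ : ∃ e : EuclideanSpace ℝ (Fin d), ‖e‖ = 1 :=
    ⟨EuclideanSpace.single ⟨0, hd⟩ 1, by simp⟩
  obtain ⟨C, hC⟩ := htail.exists_bound ha hb hp (c := 0) fun _ => hb.le
  simp only [zero_mul, Real.exp_zero, one_mul] at hC
  have hnorm : ∀ l : ℝ, 0 ≤ l → ‖l • e‖ = l := fun l hl => by
    rw [norm_smul, he, mul_one, Real.norm_of_nonneg hl]
  have hleg : IsScalarLegendre {l | l • e ∈ effDomain a} (fun l => momentReal a (l • e))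
      (fun s => Phi a (s • e)) := fun s hs => hrad.phi_smul_isGreatest ha hd he hs
  have hcubic := fun l (hl : 0 ≤ l) (hlb : l ≤ b / 2) =>
    htail.momentReal_le_cubic ha hrad hb hp he hl hlb
  have hone : ∀ l : ℝ, l • e ∈ effDomain a → 1 ≤ momentReal a (l • e) := fun l hl =>
    hrad.one_le_momentReal ha he hl
  have hle : p = 1 → ∀ l : ℝ, l • e ∈ effDomain a → l ≤ b := fun h1 l hl => by
    have h2 := (hA1 h1).norm_le hb hl
    rw [norm_smul, he, mul_one] at h2
    exact (le_abs_self l).trans h2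
  refine ⟨ha.convolutionExists hC, ha.summable_heatTerm hC, fun r hr => ?_, dirVariance a e,
    fun s => Phi a (s • e), ha.dirVariance_pos he, ha.covMatrix_eq hrad he,
    hrad.phi_eq_of_norm ha hd he, fun s hs x hx => ?_, ?_, ?_, fun h1 => ?_, fun h1 hAp => ?_,
    fun μ hμ hsupp => ?_⟩
  · obtain ⟨γ₀, hγ₀⟩ := hrad.exists_isMomentMax ha he r
    exact hγ₀.existsUnique_isXi hr ha hrad hd
  · obtain ⟨l, hl, hmem, heq⟩ := (hleg s hs).1
    exact ha.heatKernel_le_exp hrad hb hp htail he hl (fun h1 => hle h1 l hmem) hmem heq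
      (hleg.pos (half_pos hb) hcubic hs) hs hx
  · refine hleg.isEquivalent_sq (ha.dirVariance_pos he) (half_pos hb) (fun l hl => ?_) hcubic
    have h := hrad.one_add_sq_le_momentReal ha he hl
    rwa [norm_smul, he, mul_one, Real.norm_eq_abs, sq_abs] at h
  · exact hleg.tendsto_atTop (half_pos hb) (hcubic _ (half_pos hb).le le_rfl).1
  · refine hleg.isEquivalent_linear hb hone (hle h1) fun l hl hlb => ?_
    exact htail.mem_effDomain ha hb hp fun _ => by rwa [hnorm l hl]
  · have hall : ∀ γ, γ ∈ effDomain a := fun γ =>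
      htail.mem_effDomain ha hb hp fun h => absurd h h1.ne'
    have hp1 : 0 < p - 1 := by linarith
    have ht : Tendsto (fun l : ℝ => l • e) atTop (Bornology.cobounded _) := by
      rw [← tendsto_norm_atTop_iff_cobounded]
      exact tendsto_id.congr' ((eventually_ge_atTop 0).mono fun l hl => (hnorm l hl).symm)
    have hlog : (fun l => Real.log (momentReal a (l • e))) ~[atTop]
        fun l => (p - 1) / p * (b * p) ^ (-(1 / (p - 1))) * l ^ (p / (p - 1)) := by
      refine ((hAp.comp_tendsto ht).congr_left ?_).congr_right ?_
      · refine Eventually.of_forall fun l => ?_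
        simp only [Function.comp_apply]
        rw [ha.cumulant_eq hd (hall _), EReal.toReal_coe, logMoment]
      · filter_upwards [eventually_ge_atTop 0] with l hl
        simp only [Function.comp_apply]
        rw [hnorm l hl]
    refine (hleg.isEquivalent_log_rpow (by positivity) (by positivity) hone
      (fun l _ => hall _) hlog).congr_right ?_
    filter_upwards [eventually_ge_atTop 1] with s hs
    rw [rpow_constant_eq hb h1 (Real.log_nonneg hs)]
    ring
  · exact hleg.eventually_mul_log_le hμ fun η hη => hsupp.eventually_momentReal_le ha he hη
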